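/- Conventions. A closed ideal of a $C^*$-algebra is a closed two-sided ideal. A Hilbert $A$-$B$-bimodule is an $A$-$B$-bimodule $X$ that is a left Hilbert $A$-module and a right Hilbert $B$-module with ${}_A\langle x,y\rangle\cdot z=x\cdot\langle y,z\rangle_B$; it is an imprimitivity bimodule if both inner products are full. An isomorphism $(\phi_A,\phi,\phi_B)$ of Hilbert bimodules ${}_AX_B\to{}_CY_D$ consists of $*$-isomorphisms $\phi_A:A\to C$, $\phi_B:B\to D$ and a surjective map $\phi:X\to Y$ that intertwines both actions and both inner products. For Hilbert bimodules ${}_AX_B$ and ${}_BM_C$, the tensor product $X\otimes_BM$ is the Hausdorff completion of the algebraic tensor product with $\langle x\otimes m,x'\otimes m'\rangle_C=\langle m,\langle x,x'\rangle_B\cdot m'\rangle_C$ and ${}_A\langle x\otimes m,x'\otimes m'\rangle={}_A\langle x\cdot{}_B\langle m,m'\rangle,x'\rangle$. A partial action $(A,\alpha,\mathbf Z)$ consists of closed ideals $A_n\subseteq A$ and $*$-isomorphisms $\alpha_n:A_{-n}\to A_n$ $(n\in\mathbf Z)$ with $A_0=A$, $\alpha_0=\mathrm{id}$, $\alpha_m(A_{-m}\cap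 A_n)=A_m\cap A_{m+n}$, and $\alpha_m(\alpha_n(a))=\alpha_{m+n}(a)$ for $a\in A_{-n}\cap A_{-(m+n)}$. It is generated by $\alpha_1$ if for all $n\ge0$ the map $\alpha_{n+1}$ is the composition $\alpha_1\circ\alpha_n$ of partially defined maps (with its natural domain), i.e. $\alpha_n=\alpha_1^n$ as partial maps. The Hilbert bimodule ${}_AX_A$ of $(A,\alpha,\mathbf Z)$ is $X=A_1$ with $a\cdot j=aj$, $j\cdot a=\alpha_1(\alpha_1^{-1}(j)a)$, ${}_A\langle j,k\rangle=jk^*$, $\langle j,k\rangle_A=\alpha_1^{-1}(j^*k)$. Partial actions $(A,\alpha,\mathbf Z)$ and $(B,\beta,\mathbf Z)$ are Morita equivalent if there are an imprimitivity bimodule ${}_AM_B$ with $\overline{\mathrm{span}}\,A_n\cdot M=\overline{\mathrm{span}}\,M\cdot B_n=:M_n$ for all $n$, and maps $\phi_n:M_{-n}\to M_n$ such that $(\alpha_n,\phi_n,\beta_n)$ is an isomorphism from the $A_{-n}$-$B_{-n}$-bimodule $M_{-n}$ to the $A_n$-$B_n$-bimodule $M_n$ for every $n$, and $\phi_m(\phi_n(x))=\phi_{m+n}(x)$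 for all $m,n$ and all $x\in\overline{\mathrm{span}}\,M\cdot(B_{-(m+n)}\cap B_{-n})$. Hilbert bimodules ${}_AX_A$ and ${}_BY_B$ are Morita equivalent (in the sense of Abadie, Eilers and Exel) if for some imprimitivity bimodule ${}_AM_B$ there is an isomorphism $(\mathrm{id},\phi,\mathrm{id})$ from $X\otimes_AM$ to $M\otimes_BY$. Proposition. Let $(A,\alpha,\mathbf Z)$ and $(B,\beta,\mathbf Z)$ be partial actions on $C^*$-algebras with Hilbert bimodules ${}_AX_A$ and ${}_BY_B$. If the partial actions are Morita equivalent, then ${}_AX_A$ and ${}_BY_B$ are Morita equivalent. If moreover the partial actions are generated by $\alpha_1$ and $\beta_1$ respectively, then the partial actions are Morita equivalent if and only if ${}_AX_A$ and ${}_BY_B$ are Morita equivalent. -/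

import Mathlib

/-- Auxiliary: an additive group with a `B`-valued semi-inner product, linear over a right action of
`B`. Definiteness and completeness are not required. -/
structure SemiInner (X B : Type*) [AddCommGroup X] [NonUnitalCStarAlgebra B] where
  smul : X → B → X
  ip : X → X → B
  ip_add : ∀ x y z, ip x (y + z) = ip x y + ip x z
  ip_smul : ∀ x y b, ip x (smul y b) = ip x y * b
  ip_star : ∀ x y, star (ip x y) = ip y x
  ip_pos : ∀ x, ∃ c, ip x x = star c * c

theorem exists_star_mul_iff_nonneg {B : Type*} [NonUnitalCStarAlgebra B] [PartialOrder B]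
    [StarOrderedRing B] (b : B) : (∃ c, b = star c * c) ↔ 0 ≤ b := by
  constructor
  · rintro ⟨c, rfl⟩; exact star_mul_self_nonneg c
  · intro h
    obtain ⟨c, hc⟩ := (CStarAlgebra.nonneg_iff_eq_star_mul_self (a := b)).mp h
    exact ⟨c, hc⟩

/-- A criterion for positivity: no conjugate of `G` is of the form `-(R⋆ R)` with `R ≠ 0`. -/
theorem exists_star_mul_of_conj {D : Type*} [NonUnitalCStarAlgebra D] {G : D}
    (hG : IsSelfAdjoint G) (h : ∀ P R : D, star P * G * P = -(star R * R) → R = 0) :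
    ∃ K, G = star K * K := by
  let _ := CStarAlgebra.spectralOrder D
  have _ := CStarAlgebra.spectralOrderedRing D
  set P := G⁻ with hP
  have hP0 : 0 ≤ P := CFC.negPart_nonneg G
  have hPs : star P = P := (IsSelfAdjoint.of_nonneg hP0)
  have hGP : G * P = -(P * P) := by
    conv_lhs => rw [← CFC.posPart_sub_negPart G hG]
    rw [sub_mul, hP, CFC.posPart_mul_negPart, zero_sub]
  obtain ⟨Q, hQ0, hQ⟩ := CStarAlgebra.nonneg_iff_exists_nonneg_and_eq_mul_self.mp hP0
  have hQs : star Q = Q := (IsSelfAdjoint.of_nonneg hQ0)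
  have hR : P * P * P = star (Q * P) * (Q * P) := by
    rw [star_mul, hQs, hPs]
    nth_rw 2 [hQ]
    simp only [mul_assoc]
  have hPGP : star P * G * P = -(star (Q * P) * (Q * P)) := by
    rw [hPs, mul_assoc, hGP, mul_neg, ← mul_assoc, hR]
  have hzero := h _ _ hPGP
  have hP3 : P = 0 := by
    have h3 : star (P * P) * (P * P) = 0 := by
      have : P * P * P = 0 := by rw [hR, hzero, mul_zero]
      rw [star_mul, hPs, ← mul_assoc, this, zero_mul]
    have h4 := CStarRing.star_mul_self_eq_zero_iff _ |>.mp h3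
    rw [← CStarRing.star_mul_self_eq_zero_iff, hPs, h4]
  exact (exists_star_mul_iff_nonneg G).mpr ((CFC.negPart_eq_zero_iff G hG).mp hP3)

namespace SemiInner

variable {X B : Type*} [AddCommGroup X] [NonUnitalCStarAlgebra B] (S : SemiInner X B)

theorem ip_add_left (x y z : X) : S.ip (x + y) z = S.ip x z + S.ip y z := by
  rw [← S.ip_star, S.ip_add, star_add, S.ip_star, S.ip_star]

/-- The inner product as a biadditive map. -/
def ipHom : X →+ X →+ B :=
  AddMonoidHom.mk' (fun x => AddMonoidHom.mk' (S.ip x) (S.ip_add x)) fun x y => by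
    ext z; exact S.ip_add_left x y z

theorem ipHom_apply (x y : X) : S.ipHom x y = S.ip x y := rfl

theorem ip_smul_left (x y : X) (b : B) : S.ip (S.smul x b) y = star b * S.ip x y := by
  rw [← S.ip_star, S.ip_smul, star_mul, S.ip_star]

theorem ip_sub (x y z : X) : S.ip x (y - z) = S.ip x y - S.ip x z := by
  simp only [← ipHom_apply, map_sub]

theorem ip_sub_left (x y z : X) : S.ip (x - y) z = S.ip x z - S.ip y z := by
  simp only [← ipHom_apply, map_sub, AddMonoidHom.sub_apply]

theorem ip_sum {ι : Type*} (s : Finset ι) (x : X) (f : ι → X) :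
    S.ip x (∑ i ∈ s, f i) = ∑ i ∈ s, S.ip x (f i) := by
  simp only [← ipHom_apply, map_sum]

theorem ip_sum_left {ι : Type*} (s : Finset ι) (x : X) (f : ι → X) :
    S.ip (∑ i ∈ s, f i) x = ∑ i ∈ s, S.ip (f i) x := by
  simp only [← ipHom_apply, map_sum, AddMonoidHom.finsetSum_apply]

theorem norm_ip_swap (x y : X) : ‖S.ip x y‖ = ‖S.ip y x‖ := by
  rw [← S.ip_star y x, norm_star]

/-- Cauchy–Schwarz. -/
theorem cauchy_schwarz (x y : X) : ‖S.ip x y‖ ^ 2 ≤ ‖S.ip x x‖ * ‖S.ip y y‖ := by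
  let _ := CStarAlgebra.spectralOrder B
  have _ := CStarAlgebra.spectralOrderedRing B
  have key : ∀ t : ℝ, 0 < t → ‖S.ip x x‖ ≤ t → ‖S.ip x y‖ ^ 2 ≤ t * ‖S.ip y y‖ := by
    intro t ht hxt
    set a := S.ip x y with ha
    have hp : 0 ≤ S.ip (S.smul x ((t⁻¹ : ℝ) • a) - y) (S.smul x ((t⁻¹ : ℝ) • a) - y) :=
      (exists_star_mul_iff_nonneg _).mp (S.ip_pos _)
    have hsa : IsSelfAdjoint (S.ip x x) := S.ip_star x x
    have hexp : S.ip (S.smul x ((t⁻¹ : ℝ) • a) - y) (S.smul x ((t⁻¹ : ℝ) • a) - y)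
        = (t⁻¹ * t⁻¹) • (star a * S.ip x x * a) - (2 * t⁻¹) • (star a * a) + S.ip y y := by
      have hyx : S.ip y x = star a := (S.ip_star x y).symm
      simp only [S.ip_sub, S.ip_sub_left, S.ip_smul, S.ip_smul_left, hyx, ← ha, star_smul,
        star_trivial, smul_mul_assoc, mul_smul_comm, smul_smul, two_mul, add_smul]
      abel
    have h1 : star a * S.ip x x * a ≤ t • (star a * a) :=
      (CStarAlgebra.star_left_conjugate_le_norm_smul hsa).trans
        (smul_le_smul_of_nonneg_right hxt (star_mul_self_nonneg a))
    have h2 : (t⁻¹ * t⁻¹) • (star a * S.ip x x * a) ≤ t⁻¹ • (star a * a) := by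
      have := smul_le_smul_of_nonneg_left h1 (by positivity : 0 ≤ t⁻¹ * t⁻¹)
      rwa [smul_smul, mul_assoc t⁻¹, inv_mul_cancel₀ ht.ne', mul_one] at this
    have h3 : t⁻¹ • (star a * a) ≤ S.ip y y := by
      rw [hexp] at hp
      have h4 := hp.trans (add_le_add_left (sub_le_sub_right h2 _) _)
      rw [two_mul, add_smul] at h4
      rw [← sub_nonneg]
      convert h4 using 1
      abel
    have h5 := CStarAlgebra.norm_le_norm_of_nonneg_of_le
      (smul_nonneg (inv_nonneg.mpr ht.le) (star_mul_self_nonneg a)) h3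
    rw [norm_smul, CStarRing.norm_star_mul_self, Real.norm_of_nonneg (inv_nonneg.mpr ht.le),
      inv_mul_le_iff₀ ht] at h5
    rw [sq]; exact h5
  refine le_of_forall_pos_le_add fun ε hε => ?_
  have hd : 0 < ‖S.ip y y‖ + 1 := by positivity
  have := key (‖S.ip x x‖ + ε / (‖S.ip y y‖ + 1)) (by positivity) (by
    have : 0 < ε / (‖S.ip y y‖ + 1) := by positivity
    linarith)
  refine this.trans ?_
  rw [add_mul]
  gcongr
  rw [div_mul_eq_mul_div, div_le_iff₀ hd]
  nlinarith [norm_nonneg (S.ip y y)]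

theorem norm_ip_le (x y : X) : ‖S.ip x y‖ ≤ √‖S.ip x x‖ * √‖S.ip y y‖ := by
  rw [← Real.sqrt_mul (norm_nonneg _)]
  exact Real.le_sqrt_of_sq_le (S.cauchy_schwarz x y)

theorem sqrt_add_le (x y : X) :
    √‖S.ip (x + y) (x + y)‖ ≤ √‖S.ip x x‖ + √‖S.ip y y‖ := by
  refine Real.sqrt_le_left (by positivity) |>.mpr ?_
  have h1 := S.norm_ip_le x y
  have h2 := S.norm_ip_le y x
  have e : S.ip (x + y) (x + y) = S.ip x x + S.ip x y + (S.ip y x + S.ip y y) := by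
    rw [S.ip_add_left, S.ip_add, S.ip_add]
  have := (norm_add_le (S.ip x x + S.ip x y) (S.ip y x + S.ip y y)).trans
    (add_le_add (norm_add_le _ _) (norm_add_le _ _))
  rw [e]
  nlinarith [Real.sq_sqrt (norm_nonneg (S.ip x x)), Real.sq_sqrt (norm_nonneg (S.ip y y))]

theorem norm_smul_le (x : X) (b : B) :
    √‖S.ip (S.smul x b) (S.smul x b)‖ ≤ ‖b‖ * √‖S.ip x x‖ := by
  refine Real.sqrt_le_left (by positivity) |>.mpr ?_
  rw [S.ip_smul, S.ip_smul_left, mul_pow, Real.sq_sqrt (norm_nonneg _)]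
  calc _ ≤ ‖star b‖ * ‖S.ip x x‖ * ‖b‖ :=
        (norm_mul_le _ _).trans (by gcongr; exact norm_mul_le _ _)
    _ = _ := by rw [norm_star]; ring

/-- A self-adjoint element acting by adjointable maps acts with norm at most its own. -/
theorem norm_act_le {A : Type*} [NonUnitalCStarAlgebra A] (act : A →+ X →+ X)
    (hsq : ∀ b x, IsSelfAdjoint b → act (b * b) x = act b (act b x))
    (hadj : ∀ b x y, IsSelfAdjoint b → S.ip (act b x) y = S.ip x (act b y))
    (hreal : ∀ (r : ℝ) b x y, S.ip x (act (r • b) y) = r • S.ip x (act b y))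
    (b : A) (hb : IsSelfAdjoint b) (x : X) :
    ‖S.ip (act b x) (act b x)‖ ≤ ‖b‖ ^ 2 * ‖S.ip x x‖ := by
  let _ := CStarAlgebra.spectralOrder B
  have _ := CStarAlgebra.spectralOrderedRing B
  let _ := CStarAlgebra.spectralOrder A
  have _ := CStarAlgebra.spectralOrderedRing A
  rcases eq_or_ne b 0 with rfl | hb0
  · have : S.ip 0 0 = 0 := by rw [← ipHom_apply, map_zero]
    simp [this]
  have hM : 0 < ‖b‖ := norm_pos_iff.mpr hb0
  obtain ⟨c, hc, hcc⟩ : ∃ c : A, IsSelfAdjoint c ∧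
      c * c - (2 : ℝ) • c = -((‖b‖ ^ 2)⁻¹ • (b * b)) := by
    refine ⟨cfcₙ (fun t : ℝ => 1 - √(1 - (‖b‖ ^ 2)⁻¹ * (t * t))) b, cfcₙ_predicate _ _, ?_⟩
    have hcont : ContinuousOn (fun t : ℝ => 1 - √(1 - (‖b‖ ^ 2)⁻¹ * (t * t)))
      (quasispectrum ℝ b) := by fun_prop
    rw [← cfcₙ_mul _ _ b, ← cfcₙ_smul (2 : ℝ) _ b, ← cfcₙ_sub _ _ b]
    have hbb : b * b = cfcₙ (fun t : ℝ => t * t) b := by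
      rw [cfcₙ_mul _ _ b, cfcₙ_id' ℝ b]
    rw [hbb, ← cfcₙ_smul _ _ b, ← cfcₙ_neg _ b]
    refine cfcₙ_congr fun t ht => ?_
    have hle : |t| ≤ ‖b‖ := by
      simpa using NonUnitalIsometricContinuousFunctionalCalculus.norm_quasispectrum_le b ht
    have : 0 ≤ 1 - (‖b‖ ^ 2)⁻¹ * (t * t) := by
      rw [sub_nonneg, inv_mul_le_iff₀ (by positivity), mul_one, ← sq, ← sq_abs]
      gcongr
    have h2 := Real.mul_self_sqrt this
    simp only [smul_eq_mul]
    nlinarith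
  have hp : 0 ≤ S.ip (x - act c x) (x - act c x) :=
    (exists_star_mul_iff_nonneg _).mp (S.ip_pos _)
  have e1 : S.ip (x - act c x) (x - act c x)
      = S.ip x x + S.ip x (act (c * c - (2 : ℝ) • c) x) := by
    rw [S.ip_sub, S.ip_sub_left, S.ip_sub_left, hadj c x _ hc, hadj c x _ hc, ← hsq c x hc,
      map_sub, AddMonoidHom.sub_apply, S.ip_sub, hreal, two_smul]
    abel
  have e2 : S.ip x (act (c * c - (2 : ℝ) • c) x) =
      - ((‖b‖ ^ 2)⁻¹ • S.ip (act b x) (act b x)) := by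
    rw [hcc, map_neg, AddMonoidHom.neg_apply, ← ipHom_apply, map_neg, ipHom_apply, hreal,
      hsq b x hb, hadj b x _ hb]
  rw [e1, e2, ← sub_eq_add_neg, sub_nonneg] at hp
  have hp0 : 0 ≤ S.ip (act b x) (act b x) := (exists_star_mul_iff_nonneg _).mp (S.ip_pos _)
  have h5 := CStarAlgebra.norm_le_norm_of_nonneg_of_le
    (smul_nonneg (by positivity : 0 ≤ (‖b‖ ^ 2)⁻¹) hp0) hp
  rwa [norm_smul, Real.norm_of_nonneg (by positivity), inv_mul_le_iff₀ (by positivity)] at h5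

/-- The Gram matrix of finitely many vectors is of the form `K⋆ K`. -/
theorem exists_gram {n : ℕ} (x : Fin n → X) :
    ∃ K : Fin n → Fin n → B, ∀ i j, S.ip (x i) (x j) = ∑ k, star (K k i) * K k j := by
  let _ := CStarAlgebra.spectralOrder B
  have _ := CStarAlgebra.spectralOrderedRing B
  let G : CStarMatrix (Fin n) (Fin n) B :=
    CStarMatrix.ofMatrix (Matrix.of fun i j => S.ip (x i) (x j))
  have hG : IsSelfAdjoint G := by
    ext i j
    exact S.ip_star _ _
  obtain ⟨K, hK⟩ : ∃ K, G = star K * K := by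
    refine exists_star_mul_of_conj hG fun P R h => ?_
    have hdiag : ∀ i, (star P * G * P) i i =
        S.ip (∑ k, S.smul (x k) (P k i)) (∑ k, S.smul (x k) (P k i)) := by
      intro i
      rw [S.ip_sum, CStarMatrix.mul_apply]
      refine Finset.sum_congr rfl fun l _ => ?_
      rw [CStarMatrix.mul_apply, S.ip_sum_left, Finset.sum_mul]
      refine Finset.sum_congr rfl fun k _ => ?_
      rw [S.ip_smul, S.ip_smul_left]
      rfl
    ext k i
    have h1 : 0 ≤ (star P * G * P) i i := by
      rw [hdiag]; exact (exists_star_mul_iff_nonneg _).mp (S.ip_pos _)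
    have h2 : (star P * G * P) i i = - ∑ k, star (R k i) * R k i := by
      rw [h]
      rfl
    rw [h2, neg_nonneg] at h1
    have h3 : ∑ k, star (R k i) * R k i = 0 :=
      le_antisymm h1 (Finset.sum_nonneg fun k _ => star_mul_self_nonneg _)
    rw [Finset.sum_eq_zero_iff_of_nonneg (fun k _ => star_mul_self_nonneg _)] at h3
    exact CStarRing.star_mul_self_eq_zero_iff _ |>.mp (h3 k (Finset.mem_univ _))
  refine ⟨fun k i => K k i, fun i j => ?_⟩
  have : G i j = (star K * K) i j := by rw [← hK]
  exact this

theorem gram_pos {M C : Type*} [AddCommGroup M] [NonUnitalCStarAlgebra C] (T : SemiInner M C)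
    (act : B →+ M →+ M) (hmul : ∀ a b m, act (a * b) m = act a (act b m))
    (hadj : ∀ a m m', T.ip (act a m) m' = T.ip m (act (star a) m'))
    {n : ℕ} (x : Fin n → X) (m : Fin n → M) :
    ∃ c, ∑ i, ∑ j, T.ip (m i) (act (S.ip (x i) (x j)) (m j)) = star c * c := by
  let _ := CStarAlgebra.spectralOrder C
  have _ := CStarAlgebra.spectralOrderedRing C
  obtain ⟨K, hK⟩ := S.exists_gram x
  rw [exists_star_mul_iff_nonneg]
  have : ∑ i, ∑ j, T.ip (m i) (act (S.ip (x i) (x j)) (m j)) =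
      ∑ k, T.ip (∑ i, act (K k i) (m i)) (∑ j, act (K k j) (m j)) := by
    simp_rw [T.ip_sum_left, T.ip_sum, hadj, ← hmul, hK, map_sum, AddMonoidHom.finsetSum_apply,
      T.ip_sum]
    rw [Finset.sum_comm]
    conv_rhs => rw [Finset.sum_comm]
    rw [Finset.sum_comm]
    refine Finset.sum_congr rfl fun i _ => ?_
    rw [Finset.sum_comm]
  rw [this]
  exact Finset.sum_nonneg fun k _ => (exists_star_mul_iff_nonneg _).mp (T.ip_pos _)

end SemiInner

/-- A Hilbert `A`-`B`-bimodule structure on a complex normed space `X`: commuting left and right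
actions, an `A`-valued inner product (linear in the first variable) and a `B`-valued inner product
(linear in the second variable), both positive definite, with `⟨x,y⟩_A · z = x · ⟨y,z⟩_B`, and `X`
complete in the norm `‖⟨x,x⟩_B‖^{1/2}`. The norm given by the left inner product is then the same
norm (`HilbertBimodule.norm_sq_left` below), so `X` is complete in it too. -/
structure HilbertBimodule (A B X : Type*) [NonUnitalCStarAlgebra A] [NonUnitalCStarAlgebra B]
    [NormedAddCommGroup X] [NormedSpace ℂ X] where
  lsmul : A →ₗ[ℂ] X →ₗ[ℂ] X
  rsmul : X →ₗ[ℂ] B →ₗ[ℂ] X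
  linner : X →ₗ[ℂ] X →ₗ⋆[ℂ] A
  rinner : X →ₗ⋆[ℂ] X →ₗ[ℂ] B
  lsmul_mul : ∀ a a' x, lsmul (a * a') x = lsmul a (lsmul a' x)
  rsmul_mul : ∀ x b b', rsmul x (b * b') = rsmul (rsmul x b) b'
  lsmul_rsmul : ∀ a x b, lsmul a (rsmul x b) = rsmul (lsmul a x) b
  linner_lsmul : ∀ a x y, linner (lsmul a x) y = a * linner x y
  rinner_rsmul : ∀ x y b, rinner x (rsmul y b) = rinner x y * b
  star_linner : ∀ x y, star (linner x y) = linner y x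
  star_rinner : ∀ x y, star (rinner x y) = rinner y x
  -- the positive elements of a C⋆-algebra are those of the form `c⋆ c`
  linner_self_nonneg : ∀ x, ∃ c, linner x x = star c * c
  rinner_self_nonneg : ∀ x, ∃ c, rinner x x = star c * c
  linner_definite : ∀ x, linner x x = 0 → x = 0
  rinner_definite : ∀ x, rinner x x = 0 → x = 0
  linner_lsmul_eq : ∀ x y z, lsmul (linner x y) z = rsmul x (rinner y z)
  norm_sq : ∀ x, ‖x‖ ^ 2 = ‖rinner x x‖
  complete : CompleteSpace X

/-- Auxiliary: a Hilbert bimodule up to vectors of length zero and completion. -/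
structure SemiHilbertBimodule (A B E : Type*) [NonUnitalCStarAlgebra A] [NonUnitalCStarAlgebra B]
    [AddCommGroup E] [Module ℂ E] where
  lsmul : A →ₗ[ℂ] E →ₗ[ℂ] E
  rsmul : E →ₗ[ℂ] B →ₗ[ℂ] E
  linner : E →ₗ[ℂ] E →ₗ⋆[ℂ] A
  rinner : E →ₗ⋆[ℂ] E →ₗ[ℂ] B
  lsmul_mul : ∀ a a' x, lsmul (a * a') x = lsmul a (lsmul a' x)
  rsmul_mul : ∀ x b b', rsmul x (b * b') = rsmul (rsmul x b) b'
  lsmul_rsmul : ∀ a x b, lsmul a (rsmul x b) = rsmul (lsmul a x) b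
  linner_lsmul : ∀ a x y, linner (lsmul a x) y = a * linner x y
  rinner_rsmul : ∀ x y b, rinner x (rsmul y b) = rinner x y * b
  star_linner : ∀ x y, star (linner x y) = linner y x
  star_rinner : ∀ x y, star (rinner x y) = rinner y x
  linner_self_nonneg : ∀ x, ∃ c, linner x x = star c * c
  rinner_self_nonneg : ∀ x, ∃ c, rinner x x = star c * c
  linner_rsmul : ∀ x y b, linner (rsmul x b) y = linner x (rsmul y (star b))
  rinner_lsmul : ∀ x y a, rinner (lsmul a x) y = rinner x (lsmul (star a) y)
  rinner_compat : ∀ w x y z, rinner w (lsmul (linner x y) z) = rinner w (rsmul x (rinner y z))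
  linner_compat : ∀ w x y z, linner w (lsmul (linner x y) z) = linner w (rsmul x (rinner y z))

namespace SemiHilbertBimodule

variable {A B E : Type*} [NonUnitalCStarAlgebra A] [NonUnitalCStarAlgebra B]
    [AddCommGroup E] [Module ℂ E] (P : SemiHilbertBimodule A B E)

/-- The right semi-inner product module underlying `P`. -/
def right : SemiInner E B where
  smul x b := P.rsmul x b
  ip x y := P.rinner x y
  ip_add _ _ _ := map_add _ _ _
  ip_smul := P.rinner_rsmul
  ip_star := P.star_rinner
  ip_pos := P.rinner_self_nonneg

/-- The left semi-inner product module underlying `P`, turned into a right one. -/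
def left : SemiInner E A where
  smul x a := P.lsmul (star a) x
  ip x y := P.linner x y
  ip_add _ _ _ := map_add _ _ _
  ip_smul x y a := by
    rw [← P.star_linner, P.linner_lsmul, star_mul, star_star, P.star_linner]
  ip_star := P.star_linner
  ip_pos := P.linner_self_nonneg

theorem norm_le_of_cube {a b : ℝ} (ha : 0 ≤ a) (hb : 0 ≤ b) (h : a ^ 3 ≤ b ^ 2 * a) : a ≤ b := by
  rcases ha.eq_or_lt with rfl | ha'
  · exact hb
  · have : a ^ 2 ≤ b ^ 2 := le_of_mul_le_mul_right (by linarith [h, pow_succ a 2]) ha'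
    exact (pow_le_pow_iff_left₀ ha hb two_ne_zero).mp this

theorem norm_cube {D : Type*} [NonUnitalCStarAlgebra D] {a : D} (ha : star a = a) :
    ‖a‖ ^ 3 ≤ ‖a * a * a‖ := by
  rcases eq_or_ne a 0 with rfl | h0
  · simp
  have h1 : ‖a * a‖ = ‖a‖ * ‖a‖ := by
    conv_lhs => rw [← ha, ha]
    nth_rw 1 [← ha]
    exact CStarRing.norm_star_mul_self
  have h2 : ‖a * a * (a * a)‖ = ‖a * a‖ * ‖a * a‖ := by
    have : star (a * a) = a * a := by rw [star_mul, ha]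
    nth_rw 1 [← this]
    exact CStarRing.norm_star_mul_self
  have h3 : ‖a * a * (a * a)‖ ≤ ‖a * a * a‖ * ‖a‖ := by
    rw [← mul_assoc]; exact norm_mul_le _ _
  have hpos := norm_pos_iff.mpr h0
  refine le_of_mul_le_mul_right ?_ hpos
  rw [h2, h1] at h3
  nlinarith

theorem norm_linner_self (z : E) : ‖P.linner z z‖ = ‖P.rinner z z‖ := by
  set a := P.linner z z with ha
  set b := P.rinner z z with hb
  have has : star a = a := P.star_linner z z
  have hbs : star b = b := P.star_rinner z z
  apply le_antisymm
  · refine norm_le_of_cube (norm_nonneg _) (norm_nonneg _) ((norm_cube has).trans ?_)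
    let act : B →+ E →+ E := ((LinearMap.toAddMonoidHom').comp P.rsmul.flip.toAddMonoidHom)
    have h1 := P.left.norm_act_le act (fun b x _ => P.rsmul_mul x b b)
      (fun b x y h => by
        change P.linner (P.rsmul x b) y = P.linner x (P.rsmul y b)
        rw [P.linner_rsmul, h.star_eq])
      (fun r b x y => by
        change P.linner x (P.rsmul y (r • b)) = r • P.linner x (P.rsmul y b)
        rw [← Complex.coe_smul, map_smul, map_smulₛₗ, Complex.conj_ofReal, Complex.coe_smul])
      b hbs z
    have h2 : a * a * a = P.linner (P.rsmul z b) (P.rsmul z b) := by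
      have e : ∀ w, P.linner w (P.lsmul a z) = P.linner w (P.rsmul z b) :=
        fun w => P.linner_compat w z z z
      have e' : ∀ w, P.linner (P.lsmul a z) w = P.linner (P.rsmul z b) w := fun w => by
        rw [← P.star_linner, e, P.star_linner]
      have e2 : P.linner z (P.lsmul a z) = a * star a := by
        rw [← P.star_linner, P.linner_lsmul, star_mul, P.star_linner]
      rw [← e, ← e', P.linner_lsmul, e2, has, mul_assoc]
    rw [h2]
    exact h1
  · refine norm_le_of_cube (norm_nonneg _) (norm_nonneg _) ((norm_cube hbs).trans ?_)
    let act : A →+ E →+ E := ((LinearMap.toAddMonoidHom').comp P.lsmul.toAddMonoidHom)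
    have h1 := P.right.norm_act_le act (fun b x _ => P.lsmul_mul b b x)
      (fun b x y h => by
        change P.rinner (P.lsmul b x) y = P.rinner x (P.lsmul b y)
        rw [P.rinner_lsmul, h.star_eq])
      (fun r b x y => by
        change P.rinner x (P.lsmul (r • b) y) = r • P.rinner x (P.lsmul b y)
        rw [← Complex.coe_smul, map_smul, LinearMap.smul_apply, map_smul, Complex.coe_smul])
      a has z
    have h2 : b * b * b = P.rinner (P.lsmul a z) (P.lsmul a z) := by
      have e : ∀ w, P.rinner w (P.lsmul a z) = P.rinner w (P.rsmul z b) :=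
        fun w => P.rinner_compat w z z z
      have e' : ∀ w, P.rinner (P.lsmul a z) w = P.rinner (P.rsmul z b) w := fun w => by
        rw [← P.star_rinner, e, P.star_rinner]
      have e2 : P.rinner (P.rsmul z b) z = star b * b := by
        rw [← P.star_rinner, P.rinner_rsmul, star_mul, P.star_rinner]
      rw [e, e', P.rinner_rsmul, e2, hbs]
    rw [h2]
    exact h1

/-- The carrier of `P`, with the seminorm `‖⟨x,x⟩_B‖^{1/2}`. -/
def Carrier (_P : SemiHilbertBimodule A B E) : Type _ := E

instance : AddCommGroup P.Carrier := inferInstanceAs (AddCommGroup E)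

instance : Module ℂ P.Carrier := inferInstanceAs (Module ℂ E)

noncomputable instance : Norm P.Carrier := ⟨fun x : E => √‖P.rinner x x‖⟩

theorem norm_def (x : P.Carrier) : ‖x‖ = √‖P.rinner (x : E) (x : E)‖ := rfl

theorem core : SeminormedSpace.Core ℂ P.Carrier where
  norm_nonneg _ := Real.sqrt_nonneg _
  norm_smul c (x : E) := by
    change √‖P.rinner (c • x) (c • x)‖ = ‖c‖ * √‖P.rinner x x‖
    rw [map_smul, map_smulₛₗ, LinearMap.smul_apply, norm_smul, norm_smul, RCLike.norm_conj,
      ← mul_assoc, Real.sqrt_mul (by positivity), Real.sqrt_mul_self (norm_nonneg _)]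
  norm_triangle (x y : E) := P.right.sqrt_add_le x y

noncomputable instance : SeminormedAddCommGroup P.Carrier := .ofCore P.core

noncomputable instance : NormedSpace ℂ P.Carrier := { norm_smul_le := fun c x => (P.core.norm_smul c x).le }

end SemiHilbertBimodule

namespace SeminormedBimodule

section Extend

open UniformSpace

variable {V G : Type*} [SeminormedAddCommGroup V] [NormedAddCommGroup G]

/-- The extension by continuity of a bounded biadditive map to the completion. -/
noncomputable def ext₂ (f : V →+ V →+ G) : UniformSpace.Completion V → UniformSpace.Completion V → G :=
  Function.curry <| (Completion.isDenseInducing_coe.prodMap Completion.isDenseInducing_coe).extend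
    fun p : V × V => f p.1 p.2

theorem continuous_of_bound {U : Type*} [SeminormedAddCommGroup U] (f : U → V → G)
    (h1 : ∀ x x' y, f (x - x') y = f x y - f x' y) (h2 : ∀ x y y', f x (y - y') = f x y - f x y')
    (hf : ∀ x y, ‖f x y‖ ≤ ‖x‖ * ‖y‖) : Continuous fun p : U × V => f p.1 p.2 := by
  rw [continuous_iff_continuousAt]
  rintro ⟨x₀, y₀⟩
  rw [ContinuousAt, tendsto_iff_norm_sub_tendsto_zero]
  have hlim : Filter.Tendsto (fun p : U × V => ‖p.1 - x₀‖ * ‖p.2‖ + ‖x₀‖ * ‖p.2 - y₀‖)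
      (nhds (x₀, y₀)) (nhds 0) := by
    have : Continuous (fun p : U × V => ‖p.1 - x₀‖ * ‖p.2‖ + ‖x₀‖ * ‖p.2 - y₀‖) := by fun_prop
    simpa using this.tendsto (x₀, y₀)
  refine squeeze_zero (fun _ => norm_nonneg _) (fun p => ?_) hlim
  have : f p.1 p.2 - f x₀ y₀ = f (p.1 - x₀) p.2 + f x₀ (p.2 - y₀) := by
    rw [h1, h2]; abel
  rw [this]
  exact (norm_add_le _ _).trans (add_le_add (hf _ _) (hf _ _))

theorem continuous_hom (f : V →+ V →+ G) (hf : ∀ x y, ‖f x y‖ ≤ ‖x‖ * ‖y‖) :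
    Continuous fun p : V × V => f p.1 p.2 :=
  continuous_of_bound (fun x y => f x y) (fun x x' y => by simp) (fun x y y' => by simp) hf

theorem ext₂_coe (f : V →+ V →+ G) (hf : ∀ x y, ‖f x y‖ ≤ ‖x‖ * ‖y‖) (x y : V) :
    ext₂ f x y = f x y :=
  (Completion.isDenseInducing_coe.prodMap Completion.isDenseInducing_coe).extend_eq
    (continuous_hom f hf) (x, y)

theorem continuous_ext₂ [CompleteSpace G] (f : V →+ V →+ G) (hf : ∀ x y, ‖f x y‖ ≤ ‖x‖ * ‖y‖) :
    Continuous fun p : UniformSpace.Completion V × UniformSpace.Completion V => ext₂ f p.1 p.2 :=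
  (Completion.isDenseInducing_toCompl V).extend_Z_bilin (Completion.isDenseInducing_toCompl V)
    (continuous_hom f hf)

end Extend

/-- Auxiliary: a semi-Hilbert bimodule on a space that carries the corresponding seminorm. -/
structure _root_.SeminormedBimodule (A B E : Type*) [NonUnitalCStarAlgebra A]
    [NonUnitalCStarAlgebra B] [SeminormedAddCommGroup E] [NormedSpace ℂ E] extends
    SemiHilbertBimodule A B E where
  norm_def : ∀ x, ‖x‖ = √‖rinner x x‖

/-- A semi-Hilbert bimodule, on its carrier with the corresponding seminorm. -/
noncomputable def _root_.SemiHilbertBimodule.toSeminormed {A B E : Type*}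
    [NonUnitalCStarAlgebra A] [NonUnitalCStarAlgebra B] [AddCommGroup E] [Module ℂ E]
    (P : SemiHilbertBimodule A B E) : SeminormedBimodule A B P.Carrier where
  toSemiHilbertBimodule := (P : SemiHilbertBimodule A B E)
  norm_def _ := rfl

variable {A B E : Type*} [NonUnitalCStarAlgebra A] [NonUnitalCStarAlgebra B]
    [SeminormedAddCommGroup E] [NormedSpace ℂ E] (P : SeminormedBimodule A B E)

theorem norm_def' (x : E) : ‖x‖ = √‖P.linner x x‖ := by
  rw [P.norm_linner_self, P.norm_def]

theorem norm_rinner_le (x y : E) : ‖P.rinner x y‖ ≤ ‖x‖ * ‖y‖ := by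
  rw [P.norm_def, P.norm_def]; exact P.right.norm_ip_le x y

theorem norm_linner_le (x y : E) : ‖P.linner x y‖ ≤ ‖x‖ * ‖y‖ := by
  rw [P.norm_def', P.norm_def']; exact P.left.norm_ip_le x y

theorem norm_rsmul_le (x : E) (b : B) : ‖P.rsmul x b‖ ≤ ‖b‖ * ‖x‖ := by
  rw [P.norm_def, P.norm_def]; exact P.right.norm_smul_le x b

theorem norm_lsmul_le (a : A) (x : E) : ‖P.lsmul a x‖ ≤ ‖a‖ * ‖x‖ := by
  rw [P.norm_def', P.norm_def' x]
  have := P.left.norm_smul_le x (star a)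
  rw [norm_star] at this
  have e : P.left.smul x (star a) = P.lsmul a x := by
    change P.lsmul (star (star a)) x = _
    rw [star_star]
  rwa [e] at this

/-- Right multiplication by `b` as a bounded operator. -/
noncomputable def rsmulL (b : B) : E →L[ℂ] E :=
  LinearMap.mkContinuous (P.rsmul.flip b) ‖b‖ (P.norm_rsmul_le · b)

/-- Left multiplication by `a` as a bounded operator. -/
noncomputable def lsmulL (a : A) : E →L[ℂ] E :=
  LinearMap.mkContinuous (P.lsmul a) ‖a‖ (P.norm_lsmul_le a)


/-- The `B`-valued inner product on the completion. -/
noncomputable def rinnerC : UniformSpace.Completion E → UniformSpace.Completion E → B :=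
  ext₂ (V := E) ((LinearMap.toAddMonoidHom').comp P.rinner.toAddMonoidHom : E →+ E →+ B)

/-- The `A`-valued inner product on the completion. -/
noncomputable def linnerC : UniformSpace.Completion E → UniformSpace.Completion E → A :=
  ext₂ (V := E) ((LinearMap.toAddMonoidHom').comp P.linner.toAddMonoidHom : E →+ E →+ A)

/-- The left action on the completion. -/
noncomputable def lsmulC (a : A) : UniformSpace.Completion E → UniformSpace.Completion E :=
  UniformSpace.Completion.map (P.lsmulL a)

/-- The right action on the completion. -/
noncomputable def rsmulC (x : UniformSpace.Completion E) (b : B) : UniformSpace.Completion E :=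
  UniformSpace.Completion.map (P.rsmulL b) x

theorem rinnerC_coe (x y : E) : P.rinnerC x y = P.rinner x y :=
  ext₂_coe _ P.norm_rinner_le x y

theorem linnerC_coe (x y : E) : P.linnerC x y = P.linner x y :=
  ext₂_coe _ P.norm_linner_le x y

theorem lsmulC_coe (a : A) (x : E) : P.lsmulC a x = (P.lsmul a x : E) :=
  UniformSpace.Completion.map_coe (P.lsmulL a).uniformContinuous x

theorem rsmulC_coe (x : E) (b : B) :
    P.rsmulC x b = (P.rsmul x b : E) :=
  UniformSpace.Completion.map_coe (P.rsmulL b).uniformContinuous x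

@[fun_prop]
theorem continuous_rinnerC {T : Type*} [TopologicalSpace T] {f g : T → UniformSpace.Completion E}
    (hf : Continuous f) (hg : Continuous g) : Continuous fun t => P.rinnerC (f t) (g t) :=
  (continuous_ext₂ _ P.norm_rinner_le).comp (hf.prodMk hg)

@[fun_prop]
theorem continuous_linnerC {T : Type*} [TopologicalSpace T] {f g : T → UniformSpace.Completion E}
    (hf : Continuous f) (hg : Continuous g) : Continuous fun t => P.linnerC (f t) (g t) :=
  (continuous_ext₂ _ P.norm_linner_le).comp (hf.prodMk hg)

@[fun_prop]
theorem continuous_lsmulC {T : Type*} [TopologicalSpace T] (a : A) {f : T → UniformSpace.Completion E}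
    (hf : Continuous f) : Continuous fun t => P.lsmulC a (f t) :=
  UniformSpace.Completion.continuous_map.comp hf

@[fun_prop]
theorem continuous_rsmulC {T : Type*} [TopologicalSpace T] (b : B) {f : T → UniformSpace.Completion E}
    (hf : Continuous f) : Continuous fun t => P.rsmulC (f t) b :=
  UniformSpace.Completion.continuous_map.comp hf

attribute [irreducible] rinnerC linnerC lsmulC rsmulC

open UniformSpace.Completion in
theorem star_rinnerC (x y : UniformSpace.Completion E) : star (P.rinnerC x y) = P.rinnerC y x := by
  refine induction_on₂ x y (isClosed_eq (by fun_prop) (by fun_prop)) fun x y => ?_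
  rw [rinnerC_coe, rinnerC_coe, P.star_rinner]

open UniformSpace.Completion in
theorem star_linnerC (x y : UniformSpace.Completion E) : star (P.linnerC x y) = P.linnerC y x := by
  refine induction_on₂ x y (isClosed_eq (by fun_prop) (by fun_prop)) fun x y => ?_
  rw [linnerC_coe, linnerC_coe, P.star_linner]

open UniformSpace.Completion in
theorem rinnerC_add (x y z : UniformSpace.Completion E) :
    P.rinnerC x (y + z) = P.rinnerC x y + P.rinnerC x z := by
  refine induction_on₃ x y z (isClosed_eq (by fun_prop) (by fun_prop)) fun x y z => ?_
  rw [← coe_add]; simp only [rinnerC_coe]; exact map_add _ _ _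

open UniformSpace.Completion in
theorem linnerC_add (x y z : UniformSpace.Completion E) :
    P.linnerC x (y + z) = P.linnerC x y + P.linnerC x z := by
  refine induction_on₃ x y z (isClosed_eq (by fun_prop) (by fun_prop)) fun x y z => ?_
  rw [← coe_add]; simp only [linnerC_coe]; exact map_add _ _ _

open UniformSpace.Completion in
theorem rinnerC_smul (c : ℂ) (x y : UniformSpace.Completion E) :
    P.rinnerC x (c • y) = c • P.rinnerC x y := by
  refine induction_on₂ x y (isClosed_eq 
    (P.continuous_rinnerC continuous_fst (continuous_snd.const_smul c))
    ((P.continuous_rinnerC continuous_fst continuous_snd).const_smul c)) fun x y => ?_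
  rw [← coe_smul]; simp only [rinnerC_coe]; exact map_smul _ _ _

open UniformSpace.Completion in
theorem linnerC_smul (c : ℂ) (x y : UniformSpace.Completion E) :
    P.linnerC x (c • y) = (starRingEnd ℂ) c • P.linnerC x y := by
  refine induction_on₂ x y (isClosed_eq 
    (P.continuous_linnerC continuous_fst (continuous_snd.const_smul c))
    ((P.continuous_linnerC continuous_fst continuous_snd).const_smul _)) fun x y => ?_
  rw [← coe_smul]; simp only [linnerC_coe]; exact map_smulₛₗ _ _ _

open UniformSpace.Completion in
theorem norm_sqC (x : UniformSpace.Completion E) : ‖x‖ ^ 2 = ‖P.rinnerC x x‖ := by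
  refine induction_on x (isClosed_eq (by fun_prop) (by fun_prop)) fun x => ?_
  rw [norm_coe, rinnerC_coe, P.norm_def, Real.sq_sqrt (norm_nonneg _)]

open UniformSpace.Completion in
theorem norm_sqC_left (x : UniformSpace.Completion E) : ‖x‖ ^ 2 = ‖P.linnerC x x‖ := by
  refine induction_on x (isClosed_eq (by fun_prop) (by fun_prop)) fun x => ?_
  rw [norm_coe, linnerC_coe, P.norm_def, Real.sq_sqrt (norm_nonneg _), P.norm_linner_self]

theorem isClosed_star_mul {D : Type*} [NonUnitalCStarAlgebra D] :
    IsClosed {d : D | ∃ c, d = star c * c} := by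
  let _ := CStarAlgebra.spectralOrder D
  have _ := CStarAlgebra.spectralOrderedRing D
  simp only [exists_star_mul_iff_nonneg]
  exact CStarAlgebra.isClosed_nonneg

open UniformSpace.Completion in
/-- The left action on the completion, as a bilinear map. -/
noncomputable def lsmulCL :
    A →ₗ[ℂ] UniformSpace.Completion E →ₗ[ℂ] UniformSpace.Completion E :=
  LinearMap.mk₂ ℂ P.lsmulC
    (fun a a' x => by
      refine induction_on x (isClosed_eq (by fun_prop) (by fun_prop)) fun x => ?_
      simp only [lsmulC_coe, ← coe_add]; rw [map_add]; rfl)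
    (fun c a x => by
      refine induction_on x (isClosed_eq (by fun_prop) ((P.continuous_lsmulC a continuous_id).const_smul c))
        fun x => ?_
      simp only [lsmulC_coe, ← coe_smul]; rw [map_smul]; rfl)
    (fun a x y => by
      refine induction_on₂ x y (isClosed_eq (by fun_prop) (by fun_prop)) fun x y => ?_
      simp only [lsmulC_coe, ← coe_add]; congr 1; exact map_add _ _ _)
    (fun c a x => by
      refine induction_on x (isClosed_eq (P.continuous_lsmulC a (continuous_id.const_smul c))
        ((P.continuous_lsmulC a continuous_id).const_smul c)) fun x => ?_
      simp only [lsmulC_coe, ← coe_smul]; congr 1; exact map_smul _ _ _)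

open UniformSpace.Completion in
/-- The right action on the completion, as a bilinear map. -/
noncomputable def rsmulCL :
    UniformSpace.Completion E →ₗ[ℂ] B →ₗ[ℂ] UniformSpace.Completion E :=
  LinearMap.mk₂ ℂ P.rsmulC
    (fun x y b => by
      refine induction_on₂ x y (isClosed_eq (by fun_prop) (by fun_prop)) fun x y => ?_
      simp only [rsmulC_coe, ← coe_add]; congr 1; exact LinearMap.map_add₂ _ _ _ _)
    (fun c x b => by
      refine induction_on x (isClosed_eq (P.continuous_rsmulC b (continuous_id.const_smul c))
        ((P.continuous_rsmulC b continuous_id).const_smul c)) fun x => ?_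
      simp only [rsmulC_coe, ← coe_smul]; congr 1; exact LinearMap.map_smul₂ _ _ _ _)
    (fun x b b' => by
      refine induction_on x (isClosed_eq (by fun_prop) (by fun_prop)) fun x => ?_
      simp only [rsmulC_coe, ← coe_add]; congr 1; exact map_add _ _ _)
    (fun c x b => by
      refine induction_on x (isClosed_eq (by fun_prop) ((P.continuous_rsmulC b continuous_id).const_smul c))
        fun x => ?_
      simp only [rsmulC_coe, ← coe_smul]; congr 1; exact map_smul _ _ _)

open UniformSpace.Completion in
theorem norm_lsmulC_le (a : A) (x : UniformSpace.Completion E) :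
    ‖P.lsmulC a x‖ ≤ ‖a‖ * ‖x‖ := by
  refine induction_on x (isClosed_le (by fun_prop) (by fun_prop)) fun x => ?_
  rw [lsmulC_coe, norm_coe, norm_coe]; exact P.norm_lsmul_le a x

open UniformSpace.Completion in
theorem norm_rsmulC_le (x : UniformSpace.Completion E) (b : B) :
    ‖P.rsmulC x b‖ ≤ ‖x‖ * ‖b‖ := by
  refine induction_on x (isClosed_le (by fun_prop) (by fun_prop)) fun x => ?_
  rw [rsmulC_coe, norm_coe, norm_coe, mul_comm]; exact P.norm_rsmul_le x b

theorem lsmulCL_apply (a : A) (x : UniformSpace.Completion E) :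
    P.lsmulCL a x = P.lsmulC a x := rfl

theorem rsmulCL_apply (x : UniformSpace.Completion E) (b : B) :
    P.rsmulCL x b = P.rsmulC x b := rfl

theorem continuous_lsmulC₂ :
    Continuous fun p : A × UniformSpace.Completion E => P.lsmulC p.1 p.2 := by
  refine continuous_of_bound P.lsmulC ?_ ?_ P.norm_lsmulC_le
  · intro a a' x
    simp only [← lsmulCL_apply]
    rw [map_sub, LinearMap.sub_apply]
  · intro a x y
    simp only [← lsmulCL_apply]
    rw [map_sub]

theorem continuous_rsmulC₂ :
    Continuous fun p : UniformSpace.Completion E × B => P.rsmulC p.1 p.2 := by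
  refine continuous_of_bound P.rsmulC ?_ ?_ P.norm_rsmulC_le
  · intro x y b
    simp only [← rsmulCL_apply]
    rw [map_sub, LinearMap.sub_apply]
  · intro x b b'
    simp only [← rsmulCL_apply]
    rw [map_sub]

theorem compat_coe (x y z : E) :
    ((P.lsmul (P.linner x y) z : E) : UniformSpace.Completion E) =
      (P.rsmul x (P.rinner y z) : E) := by
  rw [← sub_eq_zero, ← UniformSpace.Completion.coe_sub, ← norm_eq_zero,
    UniformSpace.Completion.norm_coe, P.norm_def, map_sub _ (P.lsmul (P.linner x y) z),
    P.rinner_compat, sub_self, norm_zero, Real.sqrt_zero]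

open UniformSpace.Completion in
theorem compatC (x y z : UniformSpace.Completion E) :
    P.lsmulC (P.linnerC x y) z = P.rsmulC x (P.rinnerC y z) := by
  have h1 : Continuous fun p : UniformSpace.Completion E × UniformSpace.Completion E ×
      UniformSpace.Completion E => P.lsmulC (P.linnerC p.1 p.2.1) p.2.2 := by
    have h : Continuous fun p : UniformSpace.Completion E × UniformSpace.Completion E ×
        UniformSpace.Completion E => P.linnerC p.1 p.2.1 :=
      P.continuous_linnerC continuous_fst (continuous_fst.comp continuous_snd)
    exact P.continuous_lsmulC₂.comp (h.prodMk (continuous_snd.comp continuous_snd))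
  have h2 : Continuous fun p : UniformSpace.Completion E × UniformSpace.Completion E ×
      UniformSpace.Completion E => P.rsmulC p.1 (P.rinnerC p.2.1 p.2.2) := by
    have h : Continuous fun p : UniformSpace.Completion E × UniformSpace.Completion E ×
        UniformSpace.Completion E => P.rinnerC p.2.1 p.2.2 :=
      P.continuous_rinnerC (continuous_fst.comp continuous_snd)
        (continuous_snd.comp continuous_snd)
    exact P.continuous_rsmulC₂.comp (continuous_fst.prodMk h)
  refine induction_on₃ x y z (isClosed_eq h1 h2) fun x y z => ?_
  rw [linnerC_coe, rinnerC_coe, lsmulC_coe, rsmulC_coe, compat_coe]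

open UniformSpace.Completion in
/-- The completion of a semi-Hilbert bimodule is a Hilbert bimodule. -/
noncomputable def complete : HilbertBimodule A B (UniformSpace.Completion E) where
  lsmul := P.lsmulCL
  rsmul := P.rsmulCL
  linner := LinearMap.mk₂'ₛₗ (RingHom.id ℂ) (starRingEnd ℂ) P.linnerC
    (fun x y z => by rw [← star_linnerC, linnerC_add, star_add, star_linnerC, star_linnerC])
    (fun c x y => by rw [← star_linnerC, linnerC_smul, star_smul, star_linnerC]; simp)
    P.linnerC_add P.linnerC_smul
  rinner := LinearMap.mk₂'ₛₗ (starRingEnd ℂ) (RingHom.id ℂ) P.rinnerC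
    (fun x y z => by rw [← star_rinnerC, rinnerC_add, star_add, star_rinnerC, star_rinnerC])
    (fun c x y => by rw [← star_rinnerC, rinnerC_smul, star_smul, star_rinnerC]; simp)
    P.rinnerC_add P.rinnerC_smul
  lsmul_mul a a' x := by
    change P.lsmulC _ _ = P.lsmulC _ (P.lsmulC _ _)
    refine induction_on x (isClosed_eq (by fun_prop) (by fun_prop)) fun x => ?_
    simp only [lsmulC_coe]; rw [P.lsmul_mul]
  rsmul_mul x b b' := by
    change P.rsmulC _ _ = P.rsmulC (P.rsmulC _ _) _
    refine induction_on x (isClosed_eq (by fun_prop) (by fun_prop)) fun x => ?_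
    simp only [rsmulC_coe]; rw [P.rsmul_mul]
  lsmul_rsmul a x b := by
    change P.lsmulC _ (P.rsmulC _ _) = P.rsmulC (P.lsmulC _ _) _
    refine induction_on x (isClosed_eq (by fun_prop) (by fun_prop)) fun x => ?_
    simp only [rsmulC_coe, lsmulC_coe]; rw [P.lsmul_rsmul]
  linner_lsmul a x y := by
    change P.linnerC (P.lsmulC _ _) _ = _ * P.linnerC _ _
    refine induction_on₂ x y (isClosed_eq (by fun_prop) (by fun_prop)) fun x y => ?_
    simp only [linnerC_coe, lsmulC_coe]; rw [P.linner_lsmul]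
  rinner_rsmul x y b := by
    change P.rinnerC _ (P.rsmulC _ _) = P.rinnerC _ _ * _
    refine induction_on₂ x y (isClosed_eq (by fun_prop) (by fun_prop)) fun x y => ?_
    simp only [rinnerC_coe, rsmulC_coe]; rw [P.rinner_rsmul]
  star_linner := P.star_linnerC
  star_rinner := P.star_rinnerC
  linner_self_nonneg x := by
    change P.linnerC x x ∈ {d : A | ∃ c, d = star c * c}
    refine induction_on x (isClosed_star_mul.preimage (by fun_prop)) fun x => ?_
    rw [linnerC_coe]; exact P.linner_self_nonneg x
  rinner_self_nonneg x := by
    change P.rinnerC x x ∈ {d : B | ∃ c, d = star c * c}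
    refine induction_on x (isClosed_star_mul.preimage (by fun_prop)) fun x => ?_
    rw [rinnerC_coe]; exact P.rinner_self_nonneg x
  linner_definite x h := by
    change P.linnerC x x = 0 at h
    have := P.norm_sqC_left x
    rw [h, norm_zero] at this
    exact norm_eq_zero.mp (pow_eq_zero_iff two_ne_zero |>.mp this)
  rinner_definite x h := by
    change P.rinnerC x x = 0 at h
    have := P.norm_sqC x
    rw [h, norm_zero] at this
    exact norm_eq_zero.mp (pow_eq_zero_iff two_ne_zero |>.mp this)
  linner_lsmul_eq := P.compatC
  norm_sq := P.norm_sqC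
  complete := inferInstance

end SeminormedBimodule

namespace HilbertBimodule

variable {A B C X M : Type*} [NonUnitalCStarAlgebra A] [NonUnitalCStarAlgebra B]
    [NonUnitalCStarAlgebra C] [NormedAddCommGroup X] [NormedSpace ℂ X]
    [NormedAddCommGroup M] [NormedSpace ℂ M]

section Basic

variable (S : HilbertBimodule A B X)

theorem rinner_rsmul_left (x y : X) (b : B) :
    S.rinner (S.rsmul x b) y = star b * S.rinner x y := by
  rw [← S.star_rinner, S.rinner_rsmul, star_mul, S.star_rinner]

theorem linner_lsmul_right (x y : X) (a : A) :
    S.linner x (S.lsmul a y) = S.linner x y * star a := by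
  rw [← S.star_linner, S.linner_lsmul, star_mul, S.star_linner]

/-- The left action is by adjointable maps. -/
theorem rinner_lsmul (x y : X) (a : A) :
    S.rinner (S.lsmul a x) y = S.rinner x (S.lsmul (star a) y) := by
  rw [← sub_eq_zero, ← CStarRing.star_mul_self_eq_zero_iff, star_sub, S.star_rinner,
    S.star_rinner, sub_mul, mul_sub, mul_sub]
  have e : ∀ u v w z : X, S.rinner u v * S.rinner w z = S.rinner u (S.lsmul (S.linner v w) z) := by
    intro u v w z
    rw [S.linner_lsmul_eq, S.rinner_rsmul]
  simp only [e, S.linner_lsmul, S.linner_lsmul_right, S.lsmul_mul]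
  abel

/-- The right action is by adjointable maps. -/
theorem linner_rsmul (x y : X) (b : B) :
    S.linner (S.rsmul x b) y = S.linner x (S.rsmul y (star b)) := by
  rw [← sub_eq_zero, ← CStarRing.mul_star_self_eq_zero_iff, star_sub, S.star_linner,
    S.star_linner, sub_mul, mul_sub, mul_sub]
  have e : ∀ u v w z : X, S.linner u v * S.linner w z = S.linner (S.rsmul u (S.rinner v w)) z := by
    intro u v w z
    rw [← S.linner_lsmul_eq, S.linner_lsmul]
  simp only [e, S.rinner_rsmul, S.rinner_rsmul_left, S.rsmul_mul, star_star]
  abel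

/-- Forget completeness and definiteness. -/
def toSemi : SemiHilbertBimodule A B X where
  lsmul := S.lsmul
  rsmul := S.rsmul
  linner := S.linner
  rinner := S.rinner
  lsmul_mul := S.lsmul_mul
  rsmul_mul := S.rsmul_mul
  lsmul_rsmul := S.lsmul_rsmul
  linner_lsmul := S.linner_lsmul
  rinner_rsmul := S.rinner_rsmul
  star_linner := S.star_linner
  star_rinner := S.star_rinner
  linner_self_nonneg := S.linner_self_nonneg
  rinner_self_nonneg := S.rinner_self_nonneg
  linner_rsmul := S.linner_rsmul
  rinner_lsmul := S.rinner_lsmul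
  rinner_compat w x y z := by rw [S.linner_lsmul_eq]
  linner_compat w x y z := by rw [S.linner_lsmul_eq]

/-- Forget completeness. -/
def toSeminormed : SeminormedBimodule A B X where
  toSemiHilbertBimodule := S.toSemi
  norm_def x := by
    change ‖x‖ = √‖S.rinner x x‖
    rw [← S.norm_sq, Real.sqrt_sq (norm_nonneg x)]

/-- The norm of a Hilbert bimodule is also given by the left inner product. -/
theorem norm_sq_left (x : X) : ‖x‖ ^ 2 = ‖S.linner x x‖ := by
  rw [S.norm_sq]; exact (S.toSemi.norm_linner_self x).symm

theorem norm_rinner_le (x y : X) : ‖S.rinner x y‖ ≤ ‖x‖ * ‖y‖ :=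
  S.toSeminormed.norm_rinner_le x y

theorem norm_linner_le (x y : X) : ‖S.linner x y‖ ≤ ‖x‖ * ‖y‖ :=
  S.toSeminormed.norm_linner_le x y

theorem norm_lsmul_le (a : A) (x : X) : ‖S.lsmul a x‖ ≤ ‖a‖ * ‖x‖ :=
  S.toSeminormed.norm_lsmul_le a x

theorem norm_rsmul_le (x : X) (b : B) : ‖S.rsmul x b‖ ≤ ‖b‖ * ‖x‖ :=
  S.toSeminormed.norm_rsmul_le x b

/-- A Hilbert bimodule is an imprimitivity bimodule if it is full on both sides. -/
def IsImprimitivity : Prop :=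
  (Submodule.span ℂ {a : A | ∃ x y, S.linner x y = a}).topologicalClosure = ⊤ ∧
  (Submodule.span ℂ {b : B | ∃ x y, S.rinner x y = b}).topologicalClosure = ⊤

end Basic

/-- `(φA, φ, φB)` is an isomorphism between the Hilbert bimodules `S` and `T`. -/
structure IsIso {C D Y : Type*} [NonUnitalCStarAlgebra C] [NonUnitalCStarAlgebra D]
    [NormedAddCommGroup Y] [NormedSpace ℂ Y] (S : HilbertBimodule A B X) (T : HilbertBimodule C D Y)
    (φA : A ≃⋆ₐ[ℂ] C) (φ : X → Y) (φB : B ≃⋆ₐ[ℂ] D) : Prop where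
  map_rsmul : ∀ x b, φ (S.rsmul x b) = T.rsmul (φ x) (φB b)
  map_rinner : ∀ x y, φB (S.rinner x y) = T.rinner (φ x) (φ y)
  map_lsmul : ∀ a x, φ (S.lsmul a x) = T.lsmul (φA a) (φ x)
  map_linner : ∀ x y, φA (S.linner x y) = T.linner (φ x) (φ y)
  surjective : Function.Surjective φ

section Tensor

variable (S : HilbertBimodule A B X) (T : HilbertBimodule B C M)

open TensorProduct

/-- `⟨x ⊗ m, x' ⊗ m'⟩_C = ⟨m, ⟨x, x'⟩_B · m'⟩_C` on the algebraic tensor product. -/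
noncomputable def tensorRinner : (X ⊗[ℂ] M) →ₗ⋆[ℂ] (X ⊗[ℂ] M) →ₗ[ℂ] C :=
  TensorProduct.lift <| LinearMap.mk₂'ₛₗ (starRingEnd ℂ) (starRingEnd ℂ)
    (fun x m => TensorProduct.lift <| LinearMap.mk₂ ℂ
      (fun x' m' => T.rinner m (T.lsmul (S.rinner x x') m'))
      (by intros; simp) (by intros; simp) (by intros; simp) (by intros; simp))
    (by intros; ext; simp) (by intros; ext; simp) (by intros; ext; simp) (by intros; ext; simp)

/-- `⟨x ⊗ m, x' ⊗ m'⟩_A = ⟨x · ⟨m, m'⟩_B, x'⟩_A` on the algebraic tensor product. -/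
noncomputable def tensorLinner : (X ⊗[ℂ] M) →ₗ[ℂ] (X ⊗[ℂ] M) →ₗ⋆[ℂ] A :=
  TensorProduct.lift <| LinearMap.mk₂'ₛₗ (RingHom.id ℂ) (RingHom.id ℂ)
    (fun x m => TensorProduct.lift <| LinearMap.mk₂'ₛₗ (starRingEnd ℂ) (starRingEnd ℂ)
      (fun x' m' => S.linner (S.rsmul x (T.linner m m')) x')
      (by intros; simp) (by intros; simp) (by intros; simp) (by intros; simp))
    (by intros; ext; simp) (by intros; ext; simp) (by intros; ext; simp) (by intros; ext; simp)

@[simp]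
theorem tensorRinner_tmul (x x' : X) (m m' : M) :
    S.tensorRinner T (x ⊗ₜ m) (x' ⊗ₜ m') = T.rinner m (T.lsmul (S.rinner x x') m') := rfl

@[simp]
theorem tensorLinner_tmul (x x' : X) (m m' : M) :
    S.tensorLinner T (x ⊗ₜ m) (x' ⊗ₜ m') = S.linner (S.rsmul x (T.linner m m')) x' := rfl

/-- The algebraic tensor product of two Hilbert bimodules. -/
noncomputable def algTensor : SemiHilbertBimodule A C (X ⊗[ℂ] M) where
  lsmul := (LinearMap.rTensorHom M).comp S.lsmul
  rsmul := ((LinearMap.lTensorHom X).comp T.rsmul.flip).flip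
  linner := S.tensorLinner T
  rinner := S.tensorRinner T
  lsmul_mul a a' z := by
    induction z with
    | zero => simp
    | tmul x m => simp [S.lsmul_mul]
    | add z w hz hw => rw [map_add, map_add, map_add, hz, hw]
  rsmul_mul z c c' := by
    induction z with
    | zero => simp
    | tmul x m => simp [T.rsmul_mul]
    | add z w hz hw => simp only [map_add, LinearMap.add_apply, hz, hw]
  lsmul_rsmul a z c := by
    induction z with
    | zero => simp
    | tmul x m => simp
    | add z w hz hw => simp only [map_add, LinearMap.add_apply, hz, hw]
  linner_lsmul a z w := by
    induction z with
    | zero => simp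
    | add z z' hz hz' => simp only [map_add, LinearMap.add_apply, hz, hz', mul_add]
    | tmul x m =>
      induction w with
      | zero => simp
      | add w w' hw hw' => simp only [map_add, hw, hw', mul_add]
      | tmul x' m' => simp [← S.lsmul_rsmul, S.linner_lsmul]
  rinner_rsmul z w c := by
    induction z with
    | zero => simp
    | add z z' hz hz' => simp only [map_add, LinearMap.add_apply, hz, hz', add_mul]
    | tmul x m =>
      induction w with
      | zero => simp
      | add w w' hw hw' => simp only [map_add, LinearMap.add_apply, hw, hw', add_mul]
      | tmul x' m' => simp [T.lsmul_rsmul, T.rinner_rsmul]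
  star_linner z w := by
    induction z with
    | zero => simp
    | add z z' hz hz' => simp only [map_add, LinearMap.add_apply, hz, hz', star_add]
    | tmul x m =>
      induction w with
      | zero => simp
      | add w w' hw hw' => simp only [map_add, LinearMap.add_apply, hw, hw', star_add]
      | tmul x' m' => simp [S.star_linner, S.linner_rsmul, T.star_linner]
  star_rinner z w := by
    induction z with
    | zero => simp
    | add z z' hz hz' => simp only [map_add, LinearMap.add_apply, hz, hz', star_add]
    | tmul x m =>
      induction w with
      | zero => simp
      | add w w' hw hw' => simp only [map_add, LinearMap.add_apply, hw, hw', star_add]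
      | tmul x' m' => simp [T.star_rinner, T.rinner_lsmul, S.star_rinner]
  linner_self_nonneg z := by
    obtain ⟨n, x, m, rfl⟩ := TensorProduct.exists_sum_tmul_eq z
    let act : B →+ X →+ X := ((LinearMap.toAddMonoidHom').comp
      S.rsmul.flip.toAddMonoidHom).comp (starAddEquiv : B ≃+ B).toAddMonoidHom
    have hact : ∀ b x, act b x = S.rsmul x (star b) := fun _ _ => rfl
    obtain ⟨c, hc⟩ := T.toSemi.left.gram_pos S.toSemi.left act
      (fun a b x => by rw [hact, hact, hact, star_mul, S.rsmul_mul])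
      (fun a x x' => by
        rw [hact, hact]
        exact S.linner_rsmul x x' (star a)) m x
    refine ⟨c, ?_⟩
    rw [← hc]
    simp only [map_sum, LinearMap.sum_apply, tensorLinner_tmul, S.linner_rsmul]
    rw [Finset.sum_comm]
    rfl
  rinner_self_nonneg z := by
    obtain ⟨n, x, m, rfl⟩ := TensorProduct.exists_sum_tmul_eq z
    obtain ⟨c, hc⟩ := S.toSemi.right.gram_pos T.toSemi.right
      ((LinearMap.toAddMonoidHom').comp T.lsmul.toAddMonoidHom)
      (fun a b m => T.lsmul_mul a b m) (fun a m m' => T.rinner_lsmul m m' a) x m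
    refine ⟨c, ?_⟩
    rw [← hc]
    simp only [map_sum, LinearMap.sum_apply, tensorRinner_tmul]
    rw [Finset.sum_comm]
    rfl
  linner_rsmul z w c := by
    induction z with
    | zero => simp
    | add z z' hz hz' => simp only [map_add, LinearMap.add_apply, hz, hz']
    | tmul x m =>
      induction w with
      | zero => simp
      | add w w' hw hw' => simp only [map_add, LinearMap.add_apply, hw, hw']
      | tmul x' m' => simp [T.linner_rsmul]
  rinner_lsmul z w a := by
    induction z with
    | zero => simp
    | add z z' hz hz' => simp only [map_add, LinearMap.add_apply, hz, hz']
    | tmul x m =>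
      induction w with
      | zero => simp
      | add w w' hw hw' => simp only [map_add, hw, hw']
      | tmul x' m' => simp [S.rinner_lsmul]
  rinner_compat v z w u := by
    induction v with
    | zero => simp
    | add v v' hv hv' => simp only [map_add, LinearMap.add_apply, hv, hv']
    | tmul x m =>
      induction z with
      | zero => simp
      | add z z' hz hz' => simp only [map_add, LinearMap.add_apply, hz, hz']
      | tmul y n =>
        induction w with
        | zero => simp
        | add w w' hw hw' => simp only [map_add, LinearMap.add_apply, hw, hw']
        | tmul y' n' =>
          induction u with
          | zero => simp
          | add u u' hu hu' => simp only [map_add, hu, hu']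
          | tmul x' m' =>
            simp [S.linner_lsmul_eq, S.rinner_rsmul, T.lsmul_mul, ← T.linner_lsmul_eq]
  linner_compat v z w u := by
    induction v with
    | zero => simp
    | add v v' hv hv' => simp only [map_add, LinearMap.add_apply, hv, hv']
    | tmul x m =>
      induction z with
      | zero => simp
      | add z z' hz hz' => simp only [map_add, LinearMap.add_apply, hz, hz']
      | tmul y n =>
        induction w with
        | zero => simp
        | add w w' hw hw' => simp only [map_add, LinearMap.add_apply, hw, hw']
        | tmul y' n' =>
          induction u with
          | zero => simp
          | add u u' hu hu' => simp only [map_add, hu, hu']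
          | tmul x' m' =>
            simp [S.linner_lsmul_eq, S.linner_rsmul, S.rsmul_mul, ← T.linner_lsmul_eq,
              T.linner_lsmul_right, S.rinner_rsmul_left]

/-- The underlying Banach space of the tensor product `X ⊗_B M`: the Hausdorff completion of the
algebraic tensor product in the seminorm `‖⟨z,z⟩_C‖^{1/2}`. -/
abbrev Tensor : Type _ := UniformSpace.Completion (S.algTensor T).Carrier

/-- The balanced tensor product `X ⊗_B M` of Hilbert bimodules, with the inner products of
`tensorRinner` and `tensorLinner` extended by continuity. -/
noncomputable def tensor : HilbertBimodule A C (S.Tensor T) :=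
  (S.algTensor T).toSeminormed.complete

/-- The elementary tensor `x ⊗ m` in `X ⊗_B M`. -/
noncomputable def tmul (x : X) (m : M) : S.Tensor T :=
  UniformSpace.Completion.coe' (α := (S.algTensor T).Carrier) (x ⊗ₜ[ℂ] m : X ⊗[ℂ] M)

theorem tensor_rinner_tmul (x x' : X) (m m' : M) :
    (S.tensor T).rinner (S.tmul T x m) (S.tmul T x' m') =
      T.rinner m (T.lsmul (S.rinner x x') m') :=
  (S.algTensor T).toSeminormed.rinnerC_coe _ _

theorem tensor_linner_tmul (x x' : X) (m m' : M) :
    (S.tensor T).linner (S.tmul T x m) (S.tmul T x' m') =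
      S.linner (S.rsmul x (T.linner m m')) x' :=
  (S.algTensor T).toSeminormed.linnerC_coe _ _

theorem tensor_lsmul_tmul (a : A) (x : X) (m : M) :
    (S.tensor T).lsmul a (S.tmul T x m) = S.tmul T (S.lsmul a x) m :=
  (S.algTensor T).toSeminormed.lsmulC_coe _ _

theorem tensor_rsmul_tmul (x : X) (m : M) (c : C) :
    (S.tensor T).rsmul (S.tmul T x m) c = S.tmul T x (T.rsmul m c) :=
  (S.algTensor T).toSeminormed.rsmulC_coe _ _

theorem dense_span_tmul :
    Dense (Submodule.span ℂ {z | ∃ x m, S.tmul T x m = z} : Set (S.Tensor T)) := by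
  refine (UniformSpace.Completion.denseRange_coe (α := (S.algTensor T).Carrier)).mono ?_
  rintro _ ⟨z, rfl⟩
  obtain ⟨n, x, m, hz⟩ := TensorProduct.exists_sum_tmul_eq (R := ℂ) (M := X) (N := M) z
  have : (z : S.Tensor T) = ∑ i, S.tmul T (x i) (m i) := by
    have h := congrArg (fun w : (S.algTensor T).Carrier =>
      (UniformSpace.Completion.toComplₗᵢ (𝕜 := ℂ) w : S.Tensor T)) hz
    refine h.trans ?_
    exact map_sum (UniformSpace.Completion.toComplₗᵢ (𝕜 := ℂ) (E := (S.algTensor T).Carrier))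
      (fun i => (x i ⊗ₜ[ℂ] m i : X ⊗[ℂ] M)) Finset.univ
  rw [this]
  exact Submodule.sum_mem _ fun i _ => Submodule.subset_span ⟨_, _, rfl⟩

end Tensor

end HilbertBimodule

/-- A closed two-sided ideal of a C⋆-algebra. (Closed ideals are automatically self-adjoint; here
this is recorded as part of the structure.) -/
structure ClosedIdeal (A : Type*) [NonUnitalCStarAlgebra A] extends
    NonUnitalStarSubalgebra ℂ A where
  mul_mem_left' : ∀ a {x : A}, x ∈ carrier → a * x ∈ carrier
  mul_mem_right' : ∀ {x : A} a, x ∈ carrier → x * a ∈ carrier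
  isClosed' : IsClosed carrier

namespace ClosedIdeal

variable {A : Type*} [NonUnitalCStarAlgebra A]

instance : SetLike (ClosedIdeal A) A where
  coe I := I.carrier
  coe_injective I J h := by
    obtain ⟨⟨⟨⟩⟩⟩ := I
    obtain ⟨⟨⟨⟩⟩⟩ := J
    congr 3
    exact SetLike.coe_injective h

instance : NonUnitalSubringClass (ClosedIdeal A) A where
  add_mem {I} := I.add_mem'
  zero_mem I := I.zero_mem'
  mul_mem {I} := I.mul_mem'
  neg_mem {I} {x} h := by
    have := I.smul_mem' (-1 : ℂ) h
    rwa [neg_one_smul] at this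

instance : SMulMemClass (ClosedIdeal A) ℂ A where
  smul_mem {I} c _ h := I.smul_mem' c h

instance : StarMemClass (ClosedIdeal A) A where
  star_mem {I} := I.star_mem'

instance (I : ClosedIdeal A) : IsClosed (I : Set A) := I.isClosed'

theorem mul_mem_left (I : ClosedIdeal A) (a : A) {x : A} (h : x ∈ I) : a * x ∈ I :=
  I.mul_mem_left' a h

theorem mul_mem_right (I : ClosedIdeal A) {x : A} (a : A) (h : x ∈ I) : x * a ∈ I :=
  I.mul_mem_right' a h

/-- The intersection of two closed ideals (which is also their product). -/
instance : Min (ClosedIdeal A) where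
  min I J :=
    { I.toNonUnitalStarSubalgebra ⊓ J.toNonUnitalStarSubalgebra with
      mul_mem_left' := fun a _ h => ⟨I.mul_mem_left a h.1, J.mul_mem_left a h.2⟩
      mul_mem_right' := fun a h => ⟨I.mul_mem_right a h.1, J.mul_mem_right a h.2⟩
      isClosed' := I.isClosed'.inter J.isClosed' }

theorem mem_inf {I J : ClosedIdeal A} {a : A} : a ∈ I ⊓ J ↔ a ∈ I ∧ a ∈ J := Iff.rfl

/-- Positivity in an ideal is positivity in the algebra. -/
theorem exists_star_mul (I : ClosedIdeal A) (a : I) (h : ∃ c : A, (a : A) = star c * c) :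
    ∃ c : I, a = star c * c := by
  obtain ⟨c, hc⟩ := h
  refine exists_star_mul_of_conj ?_ fun P R hPR => ?_
  · ext
    change star (a : A) = a
    rw [hc, star_mul, star_star]
  · let _ := CStarAlgebra.spectralOrder A
    have _ := CStarAlgebra.spectralOrderedRing A
    have h1 : star (P : A) * a * P = -(star (R : A) * R) := congrArg (Subtype.val) hPR
    have h2 : star (c * P) * (c * (P : A)) = -(star (R : A) * R) := by
      rw [← h1, hc, star_mul]; simp only [mul_assoc]
    have h3 : 0 ≤ -(star (R : A) * R) := h2 ▸ star_mul_self_nonneg _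
    have h4 := le_antisymm (neg_nonneg.mp h3) (star_mul_self_nonneg _)
    ext
    exact CStarRing.star_mul_self_eq_zero_iff _ |>.mp h4

end ClosedIdeal

namespace HilbertBimodule

variable {A B X : Type*} [NonUnitalCStarAlgebra A] [NonUnitalCStarAlgebra B]
    [NormedAddCommGroup X] [NormedSpace ℂ X] (S : HilbertBimodule A B X)

/-- The closed subspace `I · X`. -/
def leftSub (I : ClosedIdeal A) : Submodule ℂ X :=
  (Submodule.span ℂ {x | ∃ a ∈ I, ∃ y, S.lsmul a y = x}).topologicalClosure

/-- The closed subspace `X · J`. -/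
def rightSub (J : ClosedIdeal B) : Submodule ℂ X :=
  (Submodule.span ℂ {x | ∃ b ∈ J, ∃ y, S.rsmul y b = x}).topologicalClosure

theorem lsmul_mem_leftSub {I : ClosedIdeal A} {a : A} (ha : a ∈ I) (x : X) :
    S.lsmul a x ∈ S.leftSub I :=
  Submodule.le_topologicalClosure _ (Submodule.subset_span ⟨a, ha, x, rfl⟩)

theorem rsmul_mem_rightSub {J : ClosedIdeal B} {b : B} (hb : b ∈ J) (x : X) :
    S.rsmul x b ∈ S.rightSub J :=
  Submodule.le_topologicalClosure _ (Submodule.subset_span ⟨b, hb, x, rfl⟩)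

theorem linner_mem {I : ClosedIdeal A} {x : X} (hx : x ∈ S.leftSub I) (y : X) :
    S.linner x y ∈ I := by
  have hcont : Continuous fun x => S.linner x y :=
    (LinearMap.mkContinuous (S.linner.flip y) ‖y‖ fun x => by
      rw [mul_comm]; exact S.norm_linner_le x y).continuous
  refine closure_minimal (s := (Submodule.span ℂ {x | ∃ a ∈ I, ∃ y, S.lsmul a y = x} : Set X))
    (t := {x | S.linner x y ∈ I}) (fun x hx => ?_) (I.isClosed'.preimage hcont) hx
  change S.linner x y ∈ I
  induction hx using Submodule.span_induction with
  | mem x h =>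
    obtain ⟨a, ha, z, rfl⟩ := h
    rw [S.linner_lsmul]
    exact I.mul_mem_right _ ha
  | zero => simp [zero_mem]
  | add x x' _ _ h h' => rw [map_add, LinearMap.add_apply]; exact add_mem h h'
  | smul c x _ h => rw [map_smul, LinearMap.smul_apply]; exact SMulMemClass.smul_mem c h

theorem rinner_mem {J : ClosedIdeal B} {y : X} (hy : y ∈ S.rightSub J) (x : X) :
    S.rinner x y ∈ J := by
  have hcont : Continuous fun y => S.rinner x y :=
    (LinearMap.mkContinuous (S.rinner x) ‖x‖ (S.norm_rinner_le x)).continuous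
  refine closure_minimal (s := (Submodule.span ℂ {x | ∃ b ∈ J, ∃ y, S.rsmul y b = x} : Set X))
    (t := {y | S.rinner x y ∈ J}) (fun y hy => ?_) (J.isClosed'.preimage hcont) hy
  change S.rinner x y ∈ J
  induction hy using Submodule.span_induction with
  | mem y h =>
    obtain ⟨b, hb, z, rfl⟩ := h
    rw [S.rinner_rsmul]
    exact J.mul_mem_left _ hb
  | zero => simp [zero_mem]
  | add x x' _ _ h h' => rw [map_add]; exact add_mem h h'
  | smul c x _ h => rw [map_smul]; exact SMulMemClass.smul_mem c h

/-- If `I · X = X · J`, this subspace is a Hilbert `I`-`J`-bimodule with the restricted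
operations. -/
noncomputable def idealSub (I : ClosedIdeal A) (J : ClosedIdeal B) (h : S.leftSub I = S.rightSub J) :
    HilbertBimodule I J (S.leftSub I) where
  lsmul := LinearMap.mk₂ ℂ (fun a x => ⟨S.lsmul a x, S.lsmul_mem_leftSub a.2 x⟩)
    (fun _ _ _ => by ext; simp) (fun _ _ _ => by ext; simp)
    (fun _ _ _ => by ext; simp) (fun _ _ _ => by ext; simp)
  rsmul := LinearMap.mk₂ ℂ (fun x b => ⟨S.rsmul x b, h.ge (S.rsmul_mem_rightSub b.2 x)⟩)
    (fun _ _ _ => by ext; simp) (fun _ _ _ => by ext; simp)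
    (fun _ _ _ => by ext; simp) (fun _ _ _ => by ext; simp)
  linner := LinearMap.mk₂'ₛₗ (RingHom.id ℂ) (starRingEnd ℂ)
    (fun x y => ⟨S.linner x y, S.linner_mem x.2 y⟩)
    (fun _ _ _ => by ext; simp) (fun _ _ _ => by ext; simp)
    (fun _ _ _ => by ext; simp) (fun _ _ _ => by ext; simp)
  rinner := LinearMap.mk₂'ₛₗ (starRingEnd ℂ) (RingHom.id ℂ)
    (fun x y => ⟨S.rinner x y, S.rinner_mem (h.le y.2) x⟩)
    (fun _ _ _ => by ext; simp) (fun _ _ _ => by ext; simp)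
    (fun _ _ _ => by ext; simp) (fun _ _ _ => by ext; simp)
  lsmul_mul a a' x := Subtype.ext (S.lsmul_mul a a' x)
  rsmul_mul x b b' := Subtype.ext (S.rsmul_mul x b b')
  lsmul_rsmul a x b := Subtype.ext (S.lsmul_rsmul a x b)
  linner_lsmul a x y := Subtype.ext (S.linner_lsmul a x y)
  rinner_rsmul x y b := Subtype.ext (S.rinner_rsmul x y b)
  star_linner x y := Subtype.ext (S.star_linner x y)
  star_rinner x y := Subtype.ext (S.star_rinner x y)
  linner_self_nonneg x := I.exists_star_mul _ (S.linner_self_nonneg x)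
  rinner_self_nonneg x := J.exists_star_mul _ (S.rinner_self_nonneg x)
  linner_definite x hx := Subtype.ext (S.linner_definite x (congrArg Subtype.val hx))
  rinner_definite x hx := Subtype.ext (S.rinner_definite x (congrArg Subtype.val hx))
  linner_lsmul_eq x y z := Subtype.ext (S.linner_lsmul_eq x y z)
  norm_sq x := S.norm_sq x
  complete :=
    have := S.complete
    (Submodule.isClosed_topologicalClosure _).completeSpace_coe

end HilbertBimodule

/-- A partial action of a (discrete) group `G`, written additively, on a C⋆-algebra `A`:
isomorphisms `α_s : A_{-s} → A_s` between closed ideals with `A_0 = A`, `α_0 = id`,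
`α_r(A_{-r} ∩ A_s) = A_r ∩ A_{r+s}`, and `α_r(α_s(a)) = α_{r+s}(a)` for
`a ∈ A_{-s} ∩ A_{-(r+s)}` (the hypothesis `h₃` then holds automatically). -/
structure PartialAction (G A : Type*) [AddGroup G] [NonUnitalCStarAlgebra A] where
  ideal : G → ClosedIdeal A
  map : ∀ s, ideal (-s) ≃⋆ₐ[ℂ] ideal s
  mem_ideal_zero : ∀ a, a ∈ ideal 0
  map_zero_apply : ∀ a : ideal (-0), (map 0 a : A) = a
  image_map : ∀ r s, (fun a : ideal (-r) => (map r a : A)) '' {a | (a : A) ∈ ideal s} =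
    (ideal r : Set A) ∩ ideal (r + s)
  map_map : ∀ r s (a : A) (h₁ : a ∈ ideal (-s)) (h₂ : a ∈ ideal (-(r + s)))
    (h₃ : (map s ⟨a, h₁⟩ : A) ∈ ideal (-r)),
    (map r ⟨map s ⟨a, h₁⟩, h₃⟩ : A) = map (r + s) ⟨a, h₂⟩

universe u v

namespace PartialAction

/-- Morita equivalence of the partial actions `α` and `β`: there are an imprimitivity bimodule `M`
with `M_s := A_s · M = M · B_s` for all `s`, and isomorphisms `(α_s, φ_s, β_s)` from `M_{-s}` onto
`M_s`, such that `φ_s(φ_t(x)) = φ_{s+t}(x)` for `x ∈ M · (B_{-(s+t)} ∩ B_{-t})` (for such `x` the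
hypotheses `h₁`, `h₂`, `h₃` hold automatically). -/
def MoritaEquivalent {G : Type*} [AddGroup G] {A : Type u} {B : Type v} [NonUnitalCStarAlgebra A]
    [NonUnitalCStarAlgebra B] (α : PartialAction G A) (β : PartialAction G B) : Prop :=
  ∃ (M : Type (max u v)) (_ : NormedAddCommGroup M) (_ : NormedSpace ℂ M)
    (S : HilbertBimodule A B M)
    (hS : ∀ s, S.leftSub (α.ideal s) = S.rightSub (β.ideal s))
    (φ : ∀ s, S.leftSub (α.ideal (-s)) → S.leftSub (α.ideal s)),
    S.IsImprimitivity ∧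
    (∀ s, HilbertBimodule.IsIso (S.idealSub _ _ (hS (-s))) (S.idealSub _ _ (hS s))
      (α.map s) (φ s) (β.map s)) ∧
    ∀ s t (x : M), x ∈ S.rightSub (β.ideal (-(s + t)) ⊓ β.ideal (-t)) →
      ∀ (h₁ : x ∈ S.leftSub (α.ideal (-t))) (h₂ : x ∈ S.leftSub (α.ideal (-(s + t))))
        (h₃ : (φ t ⟨x, h₁⟩ : M) ∈ S.leftSub (α.ideal (-s))),
        (φ s ⟨φ t ⟨x, h₁⟩, h₃⟩ : M) = φ (s + t) ⟨x, h₂⟩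

/-- The partial action `α` of `ℤ` is generated by the partial automorphism `α_1`: for `n ≥ 0`, `α_{n+1}`
is the composition `α_1 ∘ α_n` of partial maps, i.e. `α_n` is the `n`-th power of `α_1`. (For any
partial action, `α_{n+1}` extends `α_1 ∘ α_n`; what is required is that its domain is not larger.) -/
def IsGeneratedByOne {A : Type u} [NonUnitalCStarAlgebra A] (α : PartialAction ℤ A) : Prop :=
  ∀ (n : ℕ) (a : A) (h : a ∈ α.ideal (-((n : ℤ) + 1))),
    ∃ (h₁ : a ∈ α.ideal (-(n : ℤ))) (h₂ : (α.map n ⟨a, h₁⟩ : A) ∈ α.ideal (-1)),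
      (α.map (n + 1) ⟨a, h⟩ : A) = α.map 1 ⟨α.map n ⟨a, h₁⟩, h₂⟩

section Bimodule

variable {A : Type u} [NonUnitalCStarAlgebra A] (α : PartialAction ℤ A)

theorem lsmul_rsmul_aux (a : A) (j : α.ideal 1) (a' : A) (l : α.ideal 1) :
    (((α.map 1).symm (l * ⟨a * (α.map 1 ⟨(α.map 1).symm j * a',
        (α.ideal (-1)).mul_mem_right a' ((α.map 1).symm j).2⟩ : α.ideal 1),
        (α.ideal 1).mul_mem_left a (Subtype.prop _)⟩) : α.ideal (-1)) : A) =
      ((α.map 1).symm (l * α.map 1 ⟨(α.map 1).symm ⟨a * j, (α.ideal 1).mul_mem_left a j.2⟩ * a',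
        (α.ideal (-1)).mul_mem_right a' (Subtype.prop _)⟩) : α.ideal (-1)) := by
  have h1 : l * ⟨a * (α.map 1 ⟨(α.map 1).symm j * a',
      (α.ideal (-1)).mul_mem_right a' ((α.map 1).symm j).2⟩ : α.ideal 1),
      (α.ideal 1).mul_mem_left a (Subtype.prop _)⟩ =
      (⟨l * a, (α.ideal 1).mul_mem_right a l.2⟩ : α.ideal 1) *
        α.map 1 ⟨(α.map 1).symm j * a',
          (α.ideal (-1)).mul_mem_right a' ((α.map 1).symm j).2⟩ := by
    ext; simp [mul_assoc]
  have h2 : l * ⟨a * j, (α.ideal 1).mul_mem_left a j.2⟩ =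
      (⟨l * a, (α.ideal 1).mul_mem_right a l.2⟩ : α.ideal 1) * j := by
    ext; simp [mul_assoc]
  rw [h1, map_mul, map_mul, StarAlgEquiv.symm_apply_apply, StarAlgEquiv.symm_apply_apply]
  change _ * (_ * _) = (_ : A) * (_ * _)
  rw [← mul_assoc, ← mul_assoc]
  congr 1
  change ((_ * (α.map 1).symm j : α.ideal (-1)) : A) = ((α.map 1).symm l * _ : α.ideal (-1))
  rw [← map_mul, ← map_mul, h2]

/-- The Hilbert `A`-`A`-bimodule `X = A_1` of a partial action of `ℤ`: `a · j = a j`,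
`j · a = α_1(α_1⁻¹(j) a)`, `⟨j, k⟩_left = j k⋆`, `⟨j, k⟩_right = α_1⁻¹(j⋆ k)`. -/
noncomputable def bimodule : HilbertBimodule A A (α.ideal 1) where
  lsmul := LinearMap.mk₂ ℂ (fun a j => ⟨a * j, (α.ideal 1).mul_mem_left a j.2⟩)
    (fun _ _ _ => by ext; simp [add_mul]) (fun _ _ _ => by ext; simp [smul_mul_assoc])
    (fun _ _ _ => by ext; simp [mul_add]) (fun _ _ _ => by ext; simp [mul_smul_comm])
  rsmul := LinearMap.mk₂ ℂ
    (fun j a => α.map 1 ⟨(α.map 1).symm j * a,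
      (α.ideal (-1)).mul_mem_right a ((α.map 1).symm j).2⟩)
    (fun _ _ _ => by rw [← map_add]; congr 1; ext; simp [add_mul])
    (fun _ _ _ => by rw [← map_smul]; congr 1; ext; simp [smul_mul_assoc])
    (fun _ _ _ => by rw [← map_add]; congr 1; ext; simp [mul_add])
    (fun _ _ _ => by rw [← map_smul]; congr 1; ext; simp [mul_smul_comm])
  linner := LinearMap.mk₂'ₛₗ (RingHom.id ℂ) (starRingEnd ℂ) (fun j k => (j : A) * star (k : A))
    (fun _ _ _ => by simp [add_mul]) (fun _ _ _ => by simp [smul_mul_assoc])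
    (fun _ _ _ => by simp [mul_add]) (fun _ _ _ => by simp [mul_smul_comm])
  rinner := LinearMap.mk₂'ₛₗ (starRingEnd ℂ) (RingHom.id ℂ)
    (fun j k => ((α.map 1).symm (star j * k) : A))
    (fun _ _ _ => by simp [add_mul]) (fun _ _ _ => by simp [smul_mul_assoc])
    (fun _ _ _ => by simp [mul_add]) (fun _ _ _ => by simp [mul_smul_comm])
  lsmul_mul a a' j := by ext; simp [mul_assoc]
  rsmul_mul j a a' := by simp [mul_assoc]
  lsmul_rsmul a j a' := by
    suffices H : ∀ (u v : α.ideal 1), (∀ l : α.ideal 1, l * u = l * v) → u = v by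
      refine H _ _ fun l => (α.map 1).symm.injective (Subtype.ext ?_)
      exact α.lsmul_rsmul_aux a j a' l
    intro u v h
    rw [← sub_eq_zero, ← CStarRing.star_mul_self_eq_zero_iff, mul_sub, h, sub_self]
  linner_lsmul a j k := by simp [mul_assoc]
  rinner_rsmul j k a := by simp [mul_assoc]
  star_linner j k := by simp
  star_rinner j k := by
    change ((star ((α.map 1).symm (star j * k)) : α.ideal (-1)) : A) = (α.map 1).symm (star k * j)
    rw [← map_star, star_mul, star_star]
  linner_self_nonneg j := ⟨star (j : A), by simp⟩
  rinner_self_nonneg j := ⟨((α.map 1).symm j : A), by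
    change ((α.map 1).symm (star j * j) : A) = _
    rw [map_mul, map_star]
    rfl⟩
  linner_definite j h := Subtype.ext (CStarRing.mul_star_self_eq_zero_iff (j : A) |>.mp h)
  rinner_definite j h := by
    have h1 : (α.map 1).symm (star j * j) = 0 := Subtype.ext h
    have h2 : star j * j = 0 := by
      rw [← (α.map 1).apply_symm_apply (star j * j), h1, map_zero]
    exact CStarRing.star_mul_self_eq_zero_iff j |>.mp h2
  linner_lsmul_eq j k l := by
    change (⟨(j : A) * star (k : A) * l, _⟩ : α.ideal 1) =
      α.map 1 ((α.map 1).symm j * (α.map 1).symm (star k * l))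
    rw [← map_mul, StarAlgEquiv.apply_symm_apply, ← mul_assoc]
    rfl
  norm_sq j := by
    change ‖j‖ ^ 2 = ‖(α.map 1).symm (star j * j)‖
    rw [StarAlgEquiv.norm_map, CStarRing.norm_star_mul_self, sq]
  complete := inferInstance

end Bimodule

end PartialAction

/-- Morita equivalence of Hilbert bimodules `_A X_A` and `_B Y_B`: there are an imprimitivity
bimodule `_A M_B` and an isomorphism `(id, φ, id)` between `X ⊗_A M` and `M ⊗_B Y`. -/
def HilbertBimodule.MoritaEquivalent {A : Type u} {B : Type v} {X Y : Type*}
    [NonUnitalCStarAlgebra A] [NonUnitalCStarAlgebra B]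
    [NormedAddCommGroup X] [NormedSpace ℂ X] [NormedAddCommGroup Y] [NormedSpace ℂ Y]
    (S : HilbertBimodule A A X) (T : HilbertBimodule B B Y) : Prop :=
  ∃ (M : Type (max u v)) (_ : NormedAddCommGroup M) (_ : NormedSpace ℂ M)
    (N : HilbertBimodule A B M) (φ : S.Tensor N → N.Tensor T),
    N.IsImprimitivity ∧
    HilbertBimodule.IsIso (S.tensor N) (N.tensor T) (StarAlgEquiv.refl ℂ A) φ (StarAlgEquiv.refl ℂ B)

/-!
For the bimodule `X = A_1` of a partial action `α` and an imprimitivity bimodule `M`, the map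
`j ⊗ m ↦ α_1⁻¹(j) · m` identifies `X ⊗_A M` with `A_{-1} · M`, the left action being twisted by
`α_1` (`PartialAction.exists_isometry_tensor_left`); likewise `m ⊗ k ↦ m · k` identifies
`M ⊗_B Y` with `M · B_1`, the right action being twisted by `β_1⁻¹`
(`PartialAction.exists_isometry_tensor_right`). Under these identifications an isomorphism
`X ⊗_A M → M ⊗_B Y` is the same thing as a bijection `A_{-1} · M → M · B_1` that intertwines the
inner products along `α_1` and `β_1`. The map `φ_1` of a Morita equivalence of partial actions is
one, which proves the first implication.

Conversely, let `R` be the graph of such a bijection. As `M` is full, the inner products of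
elements of `A_{-1} · M` span a dense subspace of `A_{-1}`, and these are carried to inner products
of elements of `M · B_1`; hence `A_1 · M ⊆ M · B_1`, and dually `M · B_{-1} ⊆ A_{-1} · M`
(`HilbertBimodule.IsImprimitivity.leftSub_le`, `HilbertBimodule.IsImprimitivity.rightSub_le`).
Membership in `I · M` or `M · J` is a condition on `⟨x, x⟩` alone
(`HilbertBimodule.mem_leftSub_iff`), so `R` satisfies, for either inner product, the symmetric
condition `PartialAction.Implements`. If `α_1` generates `α`, an induction that uses nothing about
`M` but the `A`-valued pairing shows that the `n`-th power of `R` implements `α_n`, for every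
integer `n` (`PartialAction.Implements.relZPow`). The maps `φ_n` are these powers. Domains on the
two sides agree because both are the domain of the `n`-th power, and `φ_m ∘ φ_n ⊆ φ_{m+n}` holds
for the integer powers of any partial injection (`relZPow_comp`). Intertwining the actions need not
be checked: it follows from intertwining the inner products (`HilbertBimodule.isIso_of_inner`).
-/

/-! ### Approximate units and subspaces of Hilbert bimodules -/

namespace ClosedIdeal

variable {A : Type*} [NonUnitalCStarAlgebra A]

theorem exists_approximate_unit (I : ClosedIdeal A) {a : A} (ha : a ∈ I) {ε : ℝ} (hε : 0 < ε) :
    ∃ e ∈ I, ‖e‖ ≤ 1 ∧ ‖a - e * a‖ < ε ∧ ‖a - a * e‖ < ε := by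
  let _ := CStarAlgebra.spectralOrder I
  have _ := CStarAlgebra.spectralOrderedRing I
  have hl := CStarAlgebra.increasingApproximateUnit I
  have := hl.neBot
  have h1 := (hl.tendsto_mul_left ⟨a, ha⟩).eventually (Metric.ball_mem_nhds _ hε)
  have h2 := (hl.tendsto_mul_right ⟨a, ha⟩).eventually (Metric.ball_mem_nhds _ hε)
  obtain ⟨e, ⟨he, h1⟩, h2⟩ := ((hl.eventually_norm.and h1).and h2).exists
  rw [dist_comm, dist_eq_norm] at h1 h2
  exact ⟨e, e.2, he, h2, h1⟩

/-- Elements `c⋆ a d` with `c`, `d` in the ideal are dense in it. -/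
theorem mem_of_star_mul_mul_mem (I : ClosedIdeal A) {s : Set A} (hs : IsClosed s)
    (h : ∀ a, ∀ c ∈ I, ∀ d ∈ I, star c * a * d ∈ s) {a : A} (ha : a ∈ I) : a ∈ s := by
  rw [← hs.closure_eq, Metric.mem_closure_iff]
  intro ε hε
  obtain ⟨e, he, he1, hea, -⟩ := I.exists_approximate_unit ha (half_pos hε)
  obtain ⟨f, hf, -, -, hfa⟩ := I.exists_approximate_unit ha (half_pos hε)
  refine ⟨e * a * f, by simpa using h a (star e) (star_mem he) f hf, ?_⟩
  rw [dist_eq_norm]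
  calc ‖a - e * a * f‖ = ‖(a - e * a) + e * (a - a * f)‖ := by
        rw [mul_sub, ← mul_assoc]; congr 1; abel
    _ ≤ ‖a - e * a‖ + 1 * ‖a - a * f‖ :=
        (norm_add_le _ _).trans (by gcongr; exact (norm_mul_le _ _).trans (by gcongr))
    _ < ε := by linarith

end ClosedIdeal

namespace HilbertBimodule

section Basic

variable {A B X : Type*} [NonUnitalCStarAlgebra A] [NonUnitalCStarAlgebra B]
    [NormedAddCommGroup X] [NormedSpace ℂ X] (S : HilbertBimodule A B X)

theorem continuous_rinner : Continuous fun p : X × X => S.rinner p.1 p.2 :=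
  SeminormedBimodule.continuous_of_bound (fun x y => S.rinner x y) (fun _ _ _ => by simp)
    (fun _ _ _ => by simp) S.norm_rinner_le

theorem continuous_linner : Continuous fun p : X × X => S.linner p.1 p.2 :=
  SeminormedBimodule.continuous_of_bound (fun x y => S.linner x y) (fun _ _ _ => by simp)
    (fun _ _ _ => by simp) S.norm_linner_le

theorem continuous_lsmul : Continuous fun p : A × X => S.lsmul p.1 p.2 :=
  SeminormedBimodule.continuous_of_bound (fun a x => S.lsmul a x) (fun _ _ _ => by simp)
    (fun _ _ _ => by simp) S.norm_lsmul_le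

theorem continuous_rsmul : Continuous fun p : X × B => S.rsmul p.1 p.2 :=
  SeminormedBimodule.continuous_of_bound (fun x b => S.rsmul x b) (fun _ _ _ => by simp)
    (fun _ _ _ => by simp) fun x b => (S.norm_rsmul_le x b).trans (mul_comm _ _).le

theorem isClosed_leftSub (I : ClosedIdeal A) : IsClosed (S.leftSub I : Set X) :=
  Submodule.isClosed_topologicalClosure _

theorem isClosed_rightSub (J : ClosedIdeal B) : IsClosed (S.rightSub J : Set X) :=
  Submodule.isClosed_topologicalClosure _

theorem leftSub_le {I : ClosedIdeal A} {N : Submodule ℂ X} (hN : IsClosed (N : Set X))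
    (h : ∀ a ∈ I, ∀ x, S.lsmul a x ∈ N) : S.leftSub I ≤ N :=
  Submodule.topologicalClosure_minimal _
    (Submodule.span_le.mpr (by rintro _ ⟨a, ha, x, rfl⟩; exact h a ha x)) hN

theorem rightSub_le {J : ClosedIdeal B} {N : Submodule ℂ X} (hN : IsClosed (N : Set X))
    (h : ∀ b ∈ J, ∀ x, S.rsmul x b ∈ N) : S.rightSub J ≤ N :=
  Submodule.topologicalClosure_minimal _
    (Submodule.span_le.mpr (by rintro _ ⟨b, hb, x, rfl⟩; exact h b hb x)) hN

/-- Membership in `I · X` is detected by the left inner square: an approximate unit of `I` moves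
`x` by little if `⟨x, x⟩` lies in `I`. -/
theorem mem_leftSub_iff {I : ClosedIdeal A} {x : X} : x ∈ S.leftSub I ↔ S.linner x x ∈ I := by
  refine ⟨fun h => S.linner_mem h x, fun h => ?_⟩
  rw [← SetLike.mem_coe, ← (S.isClosed_leftSub I).closure_eq, Metric.mem_closure_iff]
  intro ε hε
  obtain ⟨e, he, he1, hea, -⟩ := I.exists_approximate_unit h (by positivity : 0 < ε ^ 2 / 2)
  refine ⟨S.lsmul e x, S.lsmul_mem_leftSub he x, ?_⟩
  rw [dist_eq_norm]
  refine lt_of_pow_lt_pow_left₀ 2 hε.le ?_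
  rw [S.norm_sq_left]
  set a := S.linner x x
  have e1 : S.linner (x - S.lsmul e x) (x - S.lsmul e x) = (a - e * a) - (a - e * a) * star e := by
    simp only [map_sub, LinearMap.sub_apply, S.linner_lsmul, S.linner_lsmul_right, sub_mul, a,
      mul_assoc]
  rw [e1]
  calc _ ≤ ‖a - e * a‖ + ‖a - e * a‖ * 1 :=
        (norm_sub_le _ _).trans (by
          gcongr; exact (norm_mul_le _ _).trans (by rw [norm_star]; gcongr))
    _ < ε ^ 2 := by linarith

theorem mem_rightSub_iff {J : ClosedIdeal B} {x : X} : x ∈ S.rightSub J ↔ S.rinner x x ∈ J := by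
  refine ⟨fun h => S.rinner_mem h x, fun h => ?_⟩
  rw [← SetLike.mem_coe, ← (S.isClosed_rightSub J).closure_eq, Metric.mem_closure_iff]
  intro ε hε
  obtain ⟨e, he, he1, -, hea⟩ := J.exists_approximate_unit h (by positivity : 0 < ε ^ 2 / 2)
  refine ⟨S.rsmul x e, S.rsmul_mem_rightSub he x, ?_⟩
  rw [dist_eq_norm]
  refine lt_of_pow_lt_pow_left₀ 2 hε.le ?_
  rw [S.norm_sq]
  set b := S.rinner x x
  have e1 : S.rinner (x - S.rsmul x e) (x - S.rsmul x e) = (b - b * e) - star e * (b - b * e) := by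
    simp only [map_sub, LinearMap.sub_apply, S.rinner_rsmul, S.rinner_rsmul_left, mul_sub, b,
      mul_assoc]
    abel
  rw [e1]
  calc _ ≤ ‖b - b * e‖ + 1 * ‖b - b * e‖ :=
        (norm_sub_le _ _).trans (by
          gcongr; exact (norm_mul_le _ _).trans (by rw [norm_star]; gcongr))
    _ < ε ^ 2 := by linarith

/-- A surjection that intertwines both inner products intertwines the actions as well. -/
theorem isIso_of_inner {C D Y : Type*} [NonUnitalCStarAlgebra C] [NonUnitalCStarAlgebra D]
    [NormedAddCommGroup Y] [NormedSpace ℂ Y] {T : HilbertBimodule C D Y} {φA : A ≃⋆ₐ[ℂ] C}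
    {φ : X → Y} {φB : B ≃⋆ₐ[ℂ] D} (hφ : Function.Surjective φ)
    (hl : ∀ x y, φA (S.linner x y) = T.linner (φ x) (φ y))
    (hr : ∀ x y, φB (S.rinner x y) = T.rinner (φ x) (φ y)) : S.IsIso T φA φ φB where
  map_rinner := hr
  map_linner := hl
  surjective := hφ
  map_rsmul x b := by
    have h : ∀ z, T.rinner z (φ (S.rsmul x b) - T.rsmul (φ x) (φB b)) = 0 := fun z => by
      obtain ⟨y, rfl⟩ := hφ z
      rw [map_sub, T.rinner_rsmul, ← hr, ← hr, S.rinner_rsmul, map_mul, sub_self]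
    exact sub_eq_zero.mp (T.rinner_definite _ (h _))
  map_lsmul a x := by
    have h : ∀ z, T.linner (φ (S.lsmul a x) - T.lsmul (φA a) (φ x)) z = 0 := fun z => by
      obtain ⟨y, rfl⟩ := hφ z
      rw [map_sub, LinearMap.sub_apply, T.linner_lsmul, ← hl, ← hl, S.linner_lsmul, map_mul,
        sub_self]
    exact sub_eq_zero.mp (T.linner_definite _ (h _))

theorem IsIso.injective {S : HilbertBimodule A B X} {C D Y : Type*} [NonUnitalCStarAlgebra C]
    [NonUnitalCStarAlgebra D] [NormedAddCommGroup Y] [NormedSpace ℂ Y] {T : HilbertBimodule C D Y}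
    {φA : A ≃⋆ₐ[ℂ] C} {φ : X → Y} {φB : B ≃⋆ₐ[ℂ] D} (h : S.IsIso T φA φ φB) :
    Function.Injective φ := fun x y hxy => by
  have e : ∀ z, S.rinner z (x - y) = 0 := fun z => by
    rw [map_sub, sub_eq_zero]
    exact φB.injective (by
      change φB _ = φB _
      rw [h.map_rinner, h.map_rinner, hxy])
  exact sub_eq_zero.mp (S.rinner_definite _ (e _))

end Basic

/-! ### Isometries out of the tensor product -/

section Tensor

variable {A B C X M : Type*} [NonUnitalCStarAlgebra A] [NonUnitalCStarAlgebra B]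
    [NonUnitalCStarAlgebra C] [NormedAddCommGroup X] [NormedSpace ℂ X]
    [NormedAddCommGroup M] [NormedSpace ℂ M] (S : HilbertBimodule A B X) (T : HilbertBimodule B C M)

open TensorProduct

theorem tensor_induction {p : S.Tensor T → Prop} (hp : IsClosed {z | p z})
    (htmul : ∀ x m, p (S.tmul T x m)) (hadd : ∀ z w, p z → p w → p (z + w)) (z : S.Tensor T) :
    p z := by
  refine UniformSpace.Completion.induction_on z hp fun w => ?_
  refine TensorProduct.induction_on (R := ℂ) (M := X) (N := M)
    (motive := fun w => p (UniformSpace.Completion.coe' (α := (S.algTensor T).Carrier) w)) w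
    ?_ htmul fun z w hz hw => ?_
  · exact TensorProduct.zero_tmul (R := ℂ) X (0 : M) ▸ htmul 0 0
  · exact UniformSpace.Completion.coe_add (α := (S.algTensor T).Carrier) z w ▸ hadd _ _ hz hw

theorem tensor_induction₂ {p : S.Tensor T → S.Tensor T → Prop}
    (hp : IsClosed {z : S.Tensor T × S.Tensor T | p z.1 z.2})
    (htmul : ∀ x m x' m', p (S.tmul T x m) (S.tmul T x' m'))
    (hadd_left : ∀ z z' w, p z w → p z' w → p (z + z') w)
    (hadd_right : ∀ z w w', p z w → p z w' → p z (w + w')) (z w : S.Tensor T) : p z w :=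
  S.tensor_induction T (p := fun z => p z w)
    (hp.preimage (continuous_id.prodMk continuous_const))
    (fun x m => S.tensor_induction T (p := p (S.tmul T x m))
      (hp.preimage (continuous_const.prodMk continuous_id))
      (htmul x m) (hadd_right _) w) (fun _ _ => hadd_left _ _ w) z

/-- A bilinear map with complete target extends to an isometry on `X ⊗_B M` if its linearization
preserves the inner squares in norm. -/
theorem exists_tensor_isometry {Z : Type*} [NormedAddCommGroup Z] [NormedSpace ℂ Z]
    [CompleteSpace Z] (F : X →ₗ[ℂ] M →ₗ[ℂ] Z)
    (hF : ∀ z, ‖TensorProduct.lift F z‖ ^ 2 = ‖S.tensorRinner T z z‖) :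
    ∃ U : S.Tensor T →ₗᵢ[ℂ] Z, ∀ x m, U (S.tmul T x m) = F x m := by
  have hF' : ∀ z, ‖TensorProduct.lift F z‖ = √‖S.tensorRinner T z z‖ := fun z => by
    rw [← hF, Real.sqrt_sq (norm_nonneg _)]
  let G : (S.algTensor T).Carrier →ₗᵢ[ℂ] Z :=
    { toLinearMap := (TensorProduct.lift F : X ⊗[ℂ] M →ₗ[ℂ] Z)
      norm_map' := hF' }
  let E : S.Tensor T →L[ℂ] Z := G.toContinuousLinearMap.extend
    (UniformSpace.Completion.toComplL (𝕜 := ℂ) (E := (S.algTensor T).Carrier))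
  have hE : ∀ z : (S.algTensor T).Carrier, E z = G z := fun z =>
    ContinuousLinearMap.extend_eq _ UniformSpace.Completion.denseRange_coe
      (UniformSpace.Completion.isUniformInducing_coe _) z
  refine ⟨{ toLinearMap := E, norm_map' := fun z => ?_ }, fun x m => hE _⟩
  refine UniformSpace.Completion.induction_on z (isClosed_eq E.continuous.norm continuous_norm)
    fun w => ?_
  change ‖E w‖ = _
  rw [hE, UniformSpace.Completion.norm_coe, G.norm_map]

theorem exists_tensor_isometry_of_rinner {D Z : Type*} [NonUnitalCStarAlgebra D]
    [NormedAddCommGroup Z] [NormedSpace ℂ Z] (P : HilbertBimodule D C Z) (F : X →ₗ[ℂ] M →ₗ[ℂ] Z)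
    (hF : ∀ x m x' m', P.rinner (F x m) (F x' m') = T.rinner m (T.lsmul (S.rinner x x') m')) :
    ∃ U : S.Tensor T →ₗᵢ[ℂ] Z, (∀ x m, U (S.tmul T x m) = F x m) ∧
      ∀ z w, P.rinner (U z) (U w) = (S.tensor T).rinner z w := by
  have := P.complete
  obtain ⟨U, hU⟩ := S.exists_tensor_isometry T F fun z => by
    rw [P.norm_sq]
    congr 1
    have h : ∀ z w : X ⊗[ℂ] M, P.rinner (TensorProduct.lift F z) (TensorProduct.lift F w) =
        S.tensorRinner T z w := fun z w => by
      induction z with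
      | zero => simp
      | add z z' hz hz' => simp only [map_add, LinearMap.add_apply, hz, hz']
      | tmul x m =>
        induction w with
        | zero => simp
        | add w w' hw hw' => simp only [map_add, hw, hw']
        | tmul x' m' => simpa using hF x m x' m'
    exact h z z
  refine ⟨U, hU, S.tensor_induction₂ T (isClosed_eq ?_ (S.tensor T).continuous_rinner) ?_ ?_ ?_⟩
  · exact P.continuous_rinner.comp (U.continuous.prodMap U.continuous)
  · intro x m x' m'
    rw [hU, hU, hF, tensor_rinner_tmul]
  · intro z z' w h h'
    simp only [map_add, LinearMap.add_apply, h, h']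
  · intro z w w' h h'
    simp only [map_add, h, h']

theorem exists_tensor_isometry_of_linner {D Z : Type*} [NonUnitalCStarAlgebra D]
    [NormedAddCommGroup Z] [NormedSpace ℂ Z] (P : HilbertBimodule A D Z) (F : X →ₗ[ℂ] M →ₗ[ℂ] Z)
    (hF : ∀ x m x' m', P.linner (F x m) (F x' m') = S.linner (S.rsmul x (T.linner m m')) x') :
    ∃ U : S.Tensor T →ₗᵢ[ℂ] Z, (∀ x m, U (S.tmul T x m) = F x m) ∧
      ∀ z w, P.linner (U z) (U w) = (S.tensor T).linner z w := by
  have := P.complete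
  obtain ⟨U, hU⟩ := S.exists_tensor_isometry T F fun z => by
    rw [P.norm_sq_left]
    refine Eq.trans (congrArg norm ?_) ((S.algTensor T).norm_linner_self z)
    have h : ∀ z w : X ⊗[ℂ] M, P.linner (TensorProduct.lift F z) (TensorProduct.lift F w) =
        S.tensorLinner T z w := fun z w => by
      induction z with
      | zero => simp
      | add z z' hz hz' => simp only [map_add, LinearMap.add_apply, hz, hz']
      | tmul x m =>
        induction w with
        | zero => simp
        | add w w' hw hw' => simp only [map_add, hw, hw']
        | tmul x' m' => simpa using hF x m x' m'
    exact h z z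
  refine ⟨U, hU, S.tensor_induction₂ T (isClosed_eq ?_ (S.tensor T).continuous_linner) ?_ ?_ ?_⟩
  · exact P.continuous_linner.comp (U.continuous.prodMap U.continuous)
  · intro x m x' m'
    rw [hU, hU, hF, tensor_linner_tmul]
  · intro z z' w h h'
    simp only [map_add, LinearMap.add_apply, h, h']
  · intro z w w' h h'
    simp only [map_add, h, h']

end Tensor

end HilbertBimodule

/-! ### Powers of partial injections and of partial actions -/

section RelPow

variable {M : Type*}

/-- The `n`-fold composite of a relation with itself. -/
def relPow (R : M → M → Prop) : ℕ → M → M → Prop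
  | 0 => Eq
  | n + 1 => Relation.Comp (relPow R n) R

theorem relPow_add (R : M → M → Prop) (m n : ℕ) :
    relPow R (m + n) = Relation.Comp (relPow R m) (relPow R n) := by
  induction n with
  | zero => exact (Relation.comp_eq (r := relPow R m)).symm
  | succ n ih =>
    rw [← add_assoc, relPow, ih, Relation.comp_assoc]
    rfl

theorem relPow_rightUnique {R : M → M → Prop} (hR : Relator.RightUnique R) (n : ℕ) :
    Relator.RightUnique (relPow R n) := by
  induction n with
  | zero => rintro x _ _ rfl rfl; rfl
  | succ n ih =>
    rintro x z z' ⟨y, hxy, hyz⟩ ⟨y', hxy', hyz'⟩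
    obtain rfl := ih hxy hxy'
    exact hR hyz hyz'

theorem relPow_leftUnique {R : M → M → Prop} (hR : Relator.LeftUnique R) (n : ℕ) :
    Relator.LeftUnique (relPow R n) := by
  induction n with
  | zero => rintro x _ _ rfl rfl; rfl
  | succ n ih =>
    rintro x z z' ⟨y, hxy, hyz⟩ ⟨y', hxy', hyz'⟩
    obtain rfl := hR hyz hyz'
    exact ih hxy hxy'

/-- The integer powers of a partial injection, given by its graph `R`: negative powers are those
of the inverse relation. -/
def relZPow (R : M → M → Prop) : ℤ → M → M → Prop
  | .ofNat n => relPow R n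
  | .negSucc n => flip (relPow R (n + 1))

theorem relZPow_natCast (R : M → M → Prop) (n : ℕ) : relZPow R n = relPow R n := rfl

theorem relZPow_neg_natCast (R : M → M → Prop) (n : ℕ) : relZPow R (-n) = flip (relPow R n) := by
  cases n with
  | zero => funext x y; exact propext eq_comm
  | succ n => rfl

theorem relZPow_rightUnique {R : M → M → Prop} (hR : Relator.RightUnique R)
    (hL : Relator.LeftUnique R) (n : ℤ) : Relator.RightUnique (relZPow R n) := by
  obtain ⟨k, rfl | rfl⟩ := n.eq_nat_or_neg
  · exact relPow_rightUnique hR k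
  · rw [relZPow_neg_natCast]; exact fun x y z h h' => relPow_leftUnique hL k h h'

/-- A power followed by another power is contained in the power of the sum. The inclusion may be
strict when the exponents have opposite signs. -/
theorem relZPow_comp {R : M → M → Prop} (hR : Relator.RightUnique R) (hL : Relator.LeftUnique R)
    {m n : ℤ} {x y z : M} (hn : relZPow R n x y) (hm : relZPow R m y z) :
    relZPow R (m + n) x z := by
  -- Cancel the common part of two powers with the same target, or with the same source.
  have sub : ∀ {j k : ℕ} {u v w : M}, j ≤ k → relPow R k u w → relPow R j v w →
      relPow R (k - j) u v := by
    intro j k u v w hjk hk hj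
    rw [← Nat.sub_add_cancel hjk, relPow_add] at hk
    obtain ⟨t, ht, htw⟩ := hk
    rwa [relPow_leftUnique hL j hj htw]
  have sub' : ∀ {j k : ℕ} {u v w : M}, j ≤ k → relPow R k u w → relPow R j u v →
      relPow R (k - j) v w := by
    intro j k u v w hjk hk hj
    rw [← Nat.add_sub_cancel' hjk, relPow_add] at hk
    obtain ⟨t, hut, ht⟩ := hk
    rwa [relPow_rightUnique hR j hj hut]
  obtain ⟨k, rfl | rfl⟩ := n.eq_nat_or_neg <;> obtain ⟨j, rfl | rfl⟩ := m.eq_nat_or_neg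
  · rw [add_comm, ← Nat.cast_add, relZPow_natCast, relPow_add]
    exact ⟨y, hn, hm⟩
  · rw [relZPow_neg_natCast] at hm
    rcases le_total j k with h | h
    · rw [neg_add_eq_sub, ← Nat.cast_sub h]
      exact sub h hn hm
    · rw [show -(j : ℤ) + k = -((j - k : ℕ) : ℤ) by rw [Nat.cast_sub h]; ring, relZPow_neg_natCast]
      exact sub h hm hn
  · rw [relZPow_neg_natCast] at hn
    rcases le_total k j with h | h
    · rw [← sub_eq_add_neg, ← Nat.cast_sub h]
      exact sub' h hm hn
    · rw [show (j : ℤ) + -k = -((k - j : ℕ) : ℤ) by rw [Nat.cast_sub h]; ring, relZPow_neg_natCast]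
      exact sub' h hn hm
  · rw [relZPow_neg_natCast] at hn hm
    rw [← neg_add, ← Nat.cast_add, relZPow_neg_natCast, flip, relPow_add]
    exact ⟨y, hm, hn⟩

end RelPow

namespace PartialAction

section Powers

variable {G A : Type*} [AddGroup G] [NonUnitalCStarAlgebra A] (α : PartialAction G A)

theorem map_congr {s t : G} (h : s = t) {a b : A} (hab : a = b) (ha : a ∈ α.ideal (-s))
    (hb : b ∈ α.ideal (-t)) : (α.map s ⟨a, ha⟩ : A) = α.map t ⟨b, hb⟩ := by
  subst h hab; rfl

/-- `α_{-s}` is the inverse of `α_s`. -/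
theorem map_neg_map (s : G) (a : α.ideal (-s)) (h : (α.map s a : A) ∈ α.ideal (-(-s))) :
    (α.map (-s) ⟨α.map s a, h⟩ : A) = a := by
  have h0 : ∀ t : G, t = 0 → ∀ ha, (α.map t ⟨(a : A), ha⟩ : A) = a := by
    rintro _ rfl ha; exact α.map_zero_apply _
  have hm : (a : A) ∈ α.ideal (-(-s + s)) := by
    rw [neg_add_cancel, neg_zero]; exact α.mem_ideal_zero _
  exact (α.map_map (-s) s a a.2 hm h).trans (h0 _ (neg_add_cancel s) hm)

theorem mem_ideal_neg_neg {s : G} {a : A} : a ∈ α.ideal (-(-s)) ↔ a ∈ α.ideal s := by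
  rw [neg_neg]

/-- The relation `R` on `M` is the graph of a bijection from `{x | ⟨x, x⟩ ∈ A_{-s}}` onto
`{y | ⟨y, y⟩ ∈ A_s}` that intertwines the `A`-valued pairing `ip` along `α_s`. (That `R` is
single-valued and injective is not part of the definition.) -/
structure Implements {M : Type*} (ip : M → M → A) (s : G) (R : M → M → Prop) : Prop where
  dom : ∀ x, ip x x ∈ α.ideal (-s) → ∃ y, R x y
  ran : ∀ y, ip y y ∈ α.ideal s → ∃ x, R x y
  map : ∀ x x' y y', R x y → R x' y' →
    ∃ h : ip x x' ∈ α.ideal (-s), (α.map s ⟨ip x x', h⟩ : A) = ip y y'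

variable {α} {M : Type*} {ip : M → M → A} {R : M → M → Prop}

theorem Implements.mem_ran {s : G} (h : α.Implements ip s R) {x x' y y' : M} (hx : R x y)
    (hx' : R x' y') : ip y y' ∈ α.ideal s := by
  obtain ⟨_, h⟩ := h.map x x' y y' hx hx'
  rw [← h]; exact Subtype.prop _

theorem Implements.flip {s : G} (h : α.Implements ip s R) : α.Implements ip (-s) (flip R) where
  dom x hx := h.ran x (α.mem_ideal_neg_neg.mp hx)
  ran y hy := h.dom y hy
  map x x' y y' hx hx' := by
    have hm := α.mem_ideal_neg_neg.mpr (h.mem_ran hx hx')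
    obtain ⟨h1, h2⟩ := h.map y y' x x' hx hx'
    exact ⟨hm, (α.map_congr rfl h2.symm _ (by rwa [h2])).trans (α.map_neg_map s ⟨_, h1⟩ _)⟩

theorem implements_zero (α : PartialAction G A) (ip : M → M → A) : α.Implements ip 0 Eq where
  dom x _ := ⟨x, rfl⟩
  ran y _ := ⟨y, rfl⟩
  map := by
    rintro x x' _ _ rfl rfl
    exact ⟨by rw [neg_zero]; exact α.mem_ideal_zero _, α.map_zero_apply _⟩

end Powers

section IntegerPowers

variable {A : Type u} {M : Type*} [NonUnitalCStarAlgebra A] {α : PartialAction ℤ A}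
    {ip : M → M → A} {R : M → M → Prop}

/-- If `α` is generated by `α_1` then the powers of a relation implementing `α_1` implement the
powers of `α_1`: the domain of `α_{n+1}` is exactly that of `α_1 ∘ α_n`. -/
theorem Implements.relPow (hα : α.IsGeneratedByOne) (h : α.Implements ip 1 R) (n : ℕ) :
    α.Implements ip n (relPow R n) := by
  induction n with
  | zero => exact α.implements_zero ip
  | succ n ih =>
    have hmap : ∀ x x' z z', _root_.relPow R (n + 1) x z → _root_.relPow R (n + 1) x' z' →
        ∃ h : ip x x' ∈ α.ideal (-((n : ℤ) + 1)),
          (α.map ((n : ℤ) + 1) ⟨ip x x', h⟩ : A) = ip z z' := by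
      rintro x x' z z' ⟨y, hxy, hyz⟩ ⟨y', hxy', hyz'⟩
      obtain ⟨h1, h2⟩ := ih.map x x' y y' hxy hxy'
      obtain ⟨h3, h4⟩ := h.map y y' z z' hyz hyz'
      -- `α_n` maps `A_{-n} ∩ A_{-(n+1)}` onto `A_n ∩ A_{-1}`, which contains `ip y y'`.
      have hm : ip x x' ∈ α.ideal (-((n : ℤ) + 1)) := by
        have : (α.map n ⟨ip x x', h1⟩ : A) ∈
            (α.ideal n : Set A) ∩ α.ideal (n + -((n : ℤ) + 1)) := by
          refine ⟨Subtype.prop _, ?_⟩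
          rw [h2, neg_add, add_neg_cancel_left]
          exact h3
        rw [← α.image_map] at this
        obtain ⟨b, hb, hbe⟩ := this
        obtain rfl := (α.map n).injective (Subtype.ext hbe)
        exact hb
      refine ⟨hm, ?_⟩
      obtain ⟨h5, h6, h7⟩ := hα n _ hm
      rw [h7, ← h4]
      exact α.map_congr rfl h2 _ _
    push_cast
    refine ⟨fun x hx => ?_, fun z hz => ?_, hmap⟩
    · obtain ⟨h1, h2, -⟩ := hα n _ hx
      obtain ⟨y, hy⟩ := ih.dom x h1
      obtain ⟨h3, h4⟩ := ih.map x x y y hy hy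
      obtain ⟨z, hz⟩ := h.dom y (by rw [← h4]; exact h2)
      exact ⟨z, y, hy, hz⟩
    · obtain ⟨⟨a, ha⟩, hae⟩ := (α.map ((n : ℤ) + 1)).surjective ⟨ip z z, hz⟩
      obtain ⟨h1, h2, h3⟩ := hα n a ha
      replace h3 : ip z z = α.map 1 _ := (congrArg Subtype.val hae).symm.trans h3
      obtain ⟨y, hy⟩ := h.ran z (by rw [h3]; exact Subtype.prop _)
      obtain ⟨h4, h5⟩ := h.map y y z z hy hy
      have h6 := (α.map 1).injective (Subtype.ext (h5.trans h3))
      replace h6 : ip y y = α.map n _ := congrArg Subtype.val h6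
      obtain ⟨x, hx⟩ := ih.ran y (by rw [h6]; exact Subtype.prop _)
      exact ⟨x, y, hx, hy⟩

theorem Implements.relZPow (hα : α.IsGeneratedByOne) (h : α.Implements ip 1 R) (n : ℤ) :
    α.Implements ip n (relZPow R n) := by
  obtain ⟨k, rfl | rfl⟩ := n.eq_nat_or_neg
  · exact h.relPow hα k
  · rw [relZPow_neg_natCast]; exact (h.relPow hα k).flip

end IntegerPowers

end PartialAction

/-! ### Ideals and fullness -/

namespace HilbertBimodule

section Full

variable {A B M : Type*} [NonUnitalCStarAlgebra A] [NonUnitalCStarAlgebra B]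
    [NormedAddCommGroup M] [NormedSpace ℂ M] (N : HilbertBimodule A B M)

theorem rsmul_mem_of_mem_rightSub {J : ClosedIdeal B} {x : M} (hx : x ∈ N.rightSub J) (b : B) :
    N.rsmul x b ∈ N.rightSub J := by
  rw [mem_rightSub_iff, N.rinner_rsmul, N.rinner_rsmul_left]
  exact J.mul_mem_right _ (J.mul_mem_left _ (N.rinner_mem hx x))

theorem lsmul_mem_of_mem_leftSub {I : ClosedIdeal A} {x : M} (hx : x ∈ N.leftSub I) (a : A) :
    N.lsmul a x ∈ N.leftSub I := by
  rw [mem_leftSub_iff, N.linner_lsmul, N.linner_lsmul_right]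
  exact I.mul_mem_left _ (I.mul_mem_right _ (N.linner_mem hx x))

variable {N}

/-- In a left full bimodule, the inner products of elements of `I · M` span a dense subspace
of `I`. -/
theorem IsImprimitivity.mem_of_linner_mem (hN : N.IsImprimitivity) {I : ClosedIdeal A}
    {P : Submodule ℂ I} (hP : IsClosed (P : Set I))
    (h : ∀ u ∈ N.leftSub I, ∀ v ∈ N.leftSub I, ∀ hI, ⟨N.linner u v, hI⟩ ∈ P) (t : I) : t ∈ P := by
  have hK : IsClosed (Subtype.val '' (P : Set I)) :=
    I.isClosed'.isClosedEmbedding_subtypeVal.isClosedMap _ hP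
  suffices H : (t : A) ∈ Subtype.val '' (P : Set I) by
    obtain ⟨t', ht, e⟩ := H
    rwa [← Subtype.ext e]
  refine I.mem_of_star_mul_mul_mem hK (fun a c hc d hd => ?_) t.2
  have ha : a ∈ (Submodule.span ℂ {a : A | ∃ x y, N.linner x y = a}).topologicalClosure := by
    rw [hN.1]; trivial
  refine closure_minimal (t := {a : A | star c * a * d ∈ Subtype.val '' (P : Set I)})
    (fun a ha => ?_) (hK.preimage (by fun_prop)) ha
  induction ha using Submodule.span_induction with
  | mem a ha =>
    obtain ⟨x, y, rfl⟩ := ha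
    have hu := N.lsmul_mem_leftSub (star_mem hc) x
    refine ⟨_, h _ hu _ (N.lsmul_mem_leftSub (star_mem hd) y) (N.linner_mem hu _), ?_⟩
    simp [N.linner_lsmul, N.linner_lsmul_right, mul_assoc]
  | zero => exact ⟨0, zero_mem P, by simp⟩
  | add a b _ _ ha hb =>
    obtain ⟨r, hr, hre⟩ := ha
    obtain ⟨s, hs, hse⟩ := hb
    exact ⟨r + s, add_mem hr hs, by simp [mul_add, add_mul, ← hre, ← hse]⟩
  | smul z a _ ha =>
    obtain ⟨r, hr, hre⟩ := ha
    exact ⟨z • r, P.smul_mem z hr, by simp [mul_smul_comm, smul_mul_assoc, ← hre]⟩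

theorem IsImprimitivity.mem_of_rinner_mem (hN : N.IsImprimitivity) {J : ClosedIdeal B}
    {P : Submodule ℂ J} (hP : IsClosed (P : Set J))
    (h : ∀ u ∈ N.rightSub J, ∀ v ∈ N.rightSub J, ∀ hJ, ⟨N.rinner u v, hJ⟩ ∈ P) (t : J) : t ∈ P := by
  have hK : IsClosed (Subtype.val '' (P : Set J)) :=
    J.isClosed'.isClosedEmbedding_subtypeVal.isClosedMap _ hP
  suffices H : (t : B) ∈ Subtype.val '' (P : Set J) by
    obtain ⟨t', ht, e⟩ := H
    rwa [← Subtype.ext e]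
  refine J.mem_of_star_mul_mul_mem hK (fun a c hc d hd => ?_) t.2
  have ha : a ∈ (Submodule.span ℂ {b : B | ∃ x y, N.rinner x y = b}).topologicalClosure := by
    rw [hN.2]; trivial
  refine closure_minimal (t := {a : B | star c * a * d ∈ Subtype.val '' (P : Set J)})
    (fun a ha => ?_) (hK.preimage (by fun_prop)) ha
  induction ha using Submodule.span_induction with
  | mem a ha =>
    obtain ⟨x, y, rfl⟩ := ha
    have hv := N.rsmul_mem_rightSub hd y
    refine ⟨_, h _ (N.rsmul_mem_rightSub hc x) _ hv (N.rinner_mem hv _), ?_⟩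
    simp [N.rinner_rsmul, N.rinner_rsmul_left, mul_assoc]
  | zero => exact ⟨0, zero_mem P, by simp⟩
  | add a b _ _ ha hb =>
    obtain ⟨r, hr, hre⟩ := ha
    obtain ⟨s, hs, hse⟩ := hb
    exact ⟨r + s, add_mem hr hs, by simp [mul_add, add_mul, ← hre, ← hse]⟩
  | smul z a _ ha =>
    obtain ⟨r, hr, hre⟩ := ha
    exact ⟨z • r, P.smul_mem z hr, by simp [mul_smul_comm, smul_mul_assoc, ← hre]⟩

/-- If `σ : I → I'` is an isomorphism of ideals, then `I' · M` is generated by the elements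
`σ(⟨u, v⟩) · x` with `u`, `v` in `I · M`. -/
theorem IsImprimitivity.leftSub_le (hN : N.IsImprimitivity) {I I' : ClosedIdeal A}
    (σ : I ≃⋆ₐ[ℂ] I') {K : Submodule ℂ M} (hK : IsClosed (K : Set M))
    (h : ∀ u ∈ N.leftSub I, ∀ v ∈ N.leftSub I, ∀ hI x, N.lsmul (σ ⟨N.linner u v, hI⟩ : A) x ∈ K) :
    N.leftSub I' ≤ K := by
  refine N.leftSub_le hK fun a ha x => ?_
  let P : Submodule ℂ I :=
    { carrier := {t | N.lsmul (σ t : A) x ∈ K}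
      add_mem' := fun {s t} hs ht => by simpa using add_mem hs ht
      zero_mem' := by simp
      smul_mem' := fun c t ht => by simpa using K.smul_mem c ht }
  have hP : IsClosed (P : Set I) := hK.preimage (N.continuous_lsmul.comp
    ((continuous_subtype_val.comp
      (AddMonoidHomClass.isometry_of_norm σ (StarAlgEquiv.norm_map _)).continuous).prodMk
      continuous_const))
  have := hN.mem_of_linner_mem hP (fun u hu v hv hI => h u hu v hv hI x) (σ.symm ⟨a, ha⟩)
  change N.lsmul (σ (σ.symm ⟨a, ha⟩) : A) x ∈ K at this
  rwa [StarAlgEquiv.apply_symm_apply] at this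

theorem IsImprimitivity.rightSub_le (hN : N.IsImprimitivity) {J J' : ClosedIdeal B}
    (σ : J ≃⋆ₐ[ℂ] J') {K : Submodule ℂ M} (hK : IsClosed (K : Set M))
    (h : ∀ u ∈ N.rightSub J, ∀ v ∈ N.rightSub J, ∀ hJ x,
      N.rsmul x (σ ⟨N.rinner u v, hJ⟩ : B) ∈ K) :
    N.rightSub J' ≤ K := by
  refine N.rightSub_le hK fun b hb x => ?_
  let P : Submodule ℂ J :=
    { carrier := {t | N.rsmul x (σ t : B) ∈ K}
      add_mem' := fun {s t} hs ht => by simpa using add_mem hs ht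
      zero_mem' := by simp
      smul_mem' := fun c t ht => by simpa using K.smul_mem c ht }
  have hP : IsClosed (P : Set J) := hK.preimage (N.continuous_rsmul.comp
    (continuous_const.prodMk (continuous_subtype_val.comp
      (AddMonoidHomClass.isometry_of_norm σ (StarAlgEquiv.norm_map _)).continuous)))
  have := hN.mem_of_rinner_mem hP (fun u hu v hv hJ => h u hu v hv hJ x) (σ.symm ⟨b, hb⟩)
  change N.rsmul x (σ (σ.symm ⟨b, hb⟩) : B) ∈ K at this
  rwa [StarAlgEquiv.apply_symm_apply] at this

end Full
end HilbertBimodule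

namespace PartialAction

/-! ### The tensor products with the bimodule of a partial action -/

section Isometries

variable {A B M : Type*} [NonUnitalCStarAlgebra A] [NonUnitalCStarAlgebra B]
    [NormedAddCommGroup M] [NormedSpace ℂ M]

theorem continuous_map {G : Type*} [AddGroup G] (α : PartialAction G A) (s : G) :
    Continuous (α.map s) :=
  (AddMonoidHomClass.isometry_of_norm (α.map s) (StarAlgEquiv.norm_map _)).continuous

theorem continuous_map_symm {G : Type*} [AddGroup G] (α : PartialAction G A) (s : G) :
    Continuous (α.map s).symm :=
  (AddMonoidHomClass.isometry_of_norm (α.map s).symm (StarAlgEquiv.norm_map _)).continuous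

/-- For the bimodule `X = A_1` of `α`, the space `X ⊗_A M` is `A_{-1} · M` with the left action
twisted by `α_1`: the isometry is `j ⊗ m ↦ α_1⁻¹(j) · m`. -/
theorem exists_isometry_tensor_left (α : PartialAction ℤ A) (N : HilbertBimodule A B M) :
    ∃ U : α.bimodule.Tensor N →ₗᵢ[ℂ] M,
      LinearMap.range U.toLinearMap = N.leftSub (α.ideal (-1)) ∧
      (∀ z w, N.rinner (U z) (U w) = (α.bimodule.tensor N).rinner z w) ∧
      ∀ z w (h : N.linner (U z) (U w) ∈ α.ideal (-1)),
        (α.map 1 ⟨_, h⟩ : A) = (α.bimodule.tensor N).linner z w := by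
  obtain ⟨U, hU, hr⟩ := α.bimodule.exists_tensor_isometry_of_rinner N N
    (LinearMap.mk₂ ℂ (fun (j : α.ideal 1) m => N.lsmul ((α.map 1).symm j : A) m)
      (by intros; simp) (by intros; simp) (by intros; simp) (by intros; simp))
    (fun j m j' m' => by
      change N.rinner (N.lsmul _ m) (N.lsmul _ m') =
        N.rinner m (N.lsmul ((α.map 1).symm (star j * j') : A) m')
      rw [N.rinner_lsmul, ← N.lsmul_mul, map_mul (α.map 1).symm, map_star (α.map 1).symm]
      rfl)
  replace hU : ∀ j m, U (α.bimodule.tmul N j m) = N.lsmul ((α.map 1).symm j : A) m := hU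
  have hmem : ∀ z, U z ∈ N.leftSub (α.ideal (-1)) :=
    α.bimodule.tensor_induction N ((N.isClosed_leftSub _).preimage U.continuous)
      (fun j m => by rw [hU]; exact N.lsmul_mem_leftSub (Subtype.prop _) m)
      (fun z w hz hw => by rw [map_add]; exact add_mem hz hw)
  refine ⟨U, le_antisymm ?_ ?_, hr, fun z w _ => ?_⟩
  · rintro _ ⟨z, rfl⟩; exact hmem z
  · refine N.leftSub_le U.isometry.isClosedEmbedding.isClosed_range fun a ha m => ?_
    exact ⟨α.bimodule.tmul N (α.map 1 ⟨a, ha⟩) m, by simp [hU]⟩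
  · have h : ∀ z w, N.linner (U z) (U w) ∈ α.ideal (-1) := fun z w => N.linner_mem (hmem z) _
    refine α.bimodule.tensor_induction₂ N
      (p := fun z w => (α.map 1 ⟨_, h z w⟩ : A) = (α.bimodule.tensor N).linner z w)
      (isClosed_eq ?_ (α.bimodule.tensor N).continuous_linner) ?_ ?_ ?_ z w
    · exact continuous_subtype_val.comp ((α.continuous_map 1).comp
        ((N.continuous_linner.comp (U.continuous.prodMap U.continuous)).subtype_mk _))
    · intro j m j' m'
      rw [HilbertBimodule.tensor_linner_tmul]
      have e : (⟨_, h (α.bimodule.tmul N j m) (α.bimodule.tmul N j' m')⟩ : α.ideal (-1)) =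
          ⟨(α.map 1).symm j * N.linner m m', (α.ideal (-1)).mul_mem_right _ (Subtype.prop _)⟩ *
            star ((α.map 1).symm j') := by
        ext
        simp [hU, N.linner_lsmul, N.linner_lsmul_right, mul_assoc]
      rw [e, map_mul, map_star, StarAlgEquiv.apply_symm_apply]
      rfl
    · intro z z' w h1 h2
      rw [map_add (α.bimodule.tensor N).linner, LinearMap.add_apply, ← h1, ← h2,
        ← AddMemClass.coe_add, ← map_add]
      congr 2
      ext
      simp
    · intro z w w' h1 h2
      rw [map_add ((α.bimodule.tensor N).linner z), ← h1, ← h2, ← AddMemClass.coe_add, ← map_add]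
      congr 2
      ext
      simp

/-- For the bimodule `Y = B_1` of `β`, the space `M ⊗_B Y` is `M · B_1` with the right action
twisted by `β_1⁻¹`: the isometry is `m ⊗ k ↦ m · k`. -/
theorem exists_isometry_tensor_right (β : PartialAction ℤ B) (N : HilbertBimodule A B M) :
    ∃ V : N.Tensor β.bimodule →ₗᵢ[ℂ] M,
      LinearMap.range V.toLinearMap = N.rightSub (β.ideal 1) ∧
      (∀ z w, N.linner (V z) (V w) = (N.tensor β.bimodule).linner z w) ∧
      ∀ z w (h : N.rinner (V z) (V w) ∈ β.ideal 1),
        ((β.map 1).symm ⟨_, h⟩ : B) = (N.tensor β.bimodule).rinner z w := by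
  obtain ⟨V, hV, hl⟩ := N.exists_tensor_isometry_of_linner β.bimodule N
    (LinearMap.mk₂ ℂ (fun m (k : β.ideal 1) => N.rsmul m (k : B))
      (by intros; simp) (by intros; simp) (by intros; simp) (by intros; simp))
    (fun m k m' k' => by
      change N.linner (N.rsmul m k) (N.rsmul m' k') =
        N.linner (N.rsmul m ((k : B) * star (k' : B))) m'
      rw [N.rsmul_mul, N.linner_rsmul _ _ (star _), star_star])
  replace hV : ∀ m (k : β.ideal 1), V (N.tmul β.bimodule m k) = N.rsmul m (k : B) := hV
  have hmem : ∀ z, V z ∈ N.rightSub (β.ideal 1) :=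
    N.tensor_induction β.bimodule ((N.isClosed_rightSub _).preimage V.continuous)
      (fun m k => by rw [hV]; exact N.rsmul_mem_rightSub (Subtype.prop _) m)
      (fun z w hz hw => by rw [map_add]; exact add_mem hz hw)
  refine ⟨V, le_antisymm ?_ ?_, hl, fun z w _ => ?_⟩
  · rintro _ ⟨z, rfl⟩; exact hmem z
  · refine N.rightSub_le V.isometry.isClosedEmbedding.isClosed_range fun b hb m => ?_
    exact ⟨N.tmul β.bimodule m ⟨b, hb⟩, hV _ _⟩
  · have h : ∀ z w, N.rinner (V z) (V w) ∈ β.ideal 1 := fun z w => N.rinner_mem (hmem w) _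
    refine N.tensor_induction₂ β.bimodule
      (p := fun z w => ((β.map 1).symm ⟨_, h z w⟩ : B) = (N.tensor β.bimodule).rinner z w)
      (isClosed_eq ?_ (N.tensor β.bimodule).continuous_rinner) ?_ ?_ ?_ z w
    · exact continuous_subtype_val.comp ((β.continuous_map_symm 1).comp
        ((N.continuous_rinner.comp (V.continuous.prodMap V.continuous)).subtype_mk _))
    · intro m k m' k'
      rw [HilbertBimodule.tensor_rinner_tmul]
      have e : (⟨_, h (N.tmul β.bimodule m k) (N.tmul β.bimodule m' k')⟩ : β.ideal 1) =
          star k * β.bimodule.lsmul (N.rinner m m') k' := by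
        ext
        change N.rinner _ _ = star (k : B) * (N.rinner m m' * k')
        simp [hV, N.rinner_rsmul, N.rinner_rsmul_left, mul_assoc]
      rw [e]
      rfl
    · intro z z' w h1 h2
      rw [map_add (N.tensor β.bimodule).rinner, LinearMap.add_apply, ← h1, ← h2,
        ← AddMemClass.coe_add, ← map_add]
      congr 2
      ext
      simp
    · intro z w w' h1 h2
      rw [map_add ((N.tensor β.bimodule).rinner z), ← h1, ← h2, ← AddMemClass.coe_add, ← map_add]
      congr 2
      ext
      simp

end Isometries

end PartialAction

/-! ### Morita equivalence -/

namespace PartialAction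

variable {A : Type u} {B : Type v} [NonUnitalCStarAlgebra A] [NonUnitalCStarAlgebra B]
    {α : PartialAction ℤ A} {β : PartialAction ℤ B}

theorem MoritaEquivalent.bimodule (h : α.MoritaEquivalent β) :
    α.bimodule.MoritaEquivalent β.bimodule := by
  obtain ⟨M, _, _, N, hN, φ, himp, hiso, -⟩ := h
  obtain ⟨U, hU, hUr, hUl⟩ := α.exists_isometry_tensor_left N
  obtain ⟨V, hV, hVl, hVr⟩ := β.exists_isometry_tensor_right N
  have hUm : ∀ z, U z ∈ N.leftSub (α.ideal (-1)) := fun z => hU ▸ ⟨z, rfl⟩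
  have hex : ∀ z, ∃ w, V w = φ 1 ⟨U z, hUm z⟩ := fun z => by
    have : (φ 1 ⟨U z, hUm z⟩ : M) ∈ LinearMap.range V.toLinearMap := by
      rw [hV, ← hN]; exact Subtype.prop _
    exact this
  choose Ψ hΨ using hex
  refine ⟨M, _, _, N, Ψ, himp, HilbertBimodule.isIso_of_inner _ (fun w => ?_) (fun z w => ?_)
    fun z w => ?_⟩
  · have hw : V w ∈ N.leftSub (α.ideal 1) := by rw [hN, ← hV]; exact ⟨w, rfl⟩
    obtain ⟨⟨x, hx⟩, hxw⟩ := (hiso 1).surjective ⟨V w, hw⟩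
    have hx' := hx
    rw [← hU] at hx'
    obtain ⟨z, rfl⟩ := hx'
    exact ⟨z, V.injective ((hΨ z).trans (congrArg Subtype.val hxw))⟩
  · rw [← hVl, hΨ, hΨ]
    exact (hUl z w (N.linner_mem (hUm z) _)).symm.trans
      (congrArg Subtype.val ((hiso 1).map_linner ⟨_, hUm z⟩ ⟨_, hUm w⟩))
  · have hm : N.rinner (V (Ψ z)) (V (Ψ w)) ∈ β.ideal 1 :=
      N.rinner_mem (hV ▸ ⟨Ψ w, rfl⟩ : V (Ψ w) ∈ _) _
    have hm' : N.rinner (U z) (U w) ∈ β.ideal (-1) := N.rinner_mem (hN (-1) ▸ hUm w) _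
    have e : β.map 1 ⟨_, hm'⟩ = ⟨_, hm⟩ := by
      ext
      change _ = N.rinner (V (Ψ z)) (V (Ψ w))
      rw [hΨ, hΨ]
      exact congrArg Subtype.val ((hiso 1).map_rinner ⟨_, hUm z⟩ ⟨_, hUm w⟩)
    rw [← hVr _ _ hm, ← e, StarAlgEquiv.symm_apply_apply]
    exact (hUr z w).symm

/-- A relation on an imprimitivity bimodule that implements `α_1` and `β_1`, for the left and the
right inner product, yields a Morita equivalence, `φ_n` being its `n`-th power. -/
theorem moritaEquivalent_of_implements (hα : α.IsGeneratedByOne) (hβ : β.IsGeneratedByOne)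
    {M : Type (max u v)} [NormedAddCommGroup M] [NormedSpace ℂ M] {N : HilbertBimodule A B M}
    (hN : N.IsImprimitivity) {R : M → M → Prop} (hRu : Relator.RightUnique R)
    (hLu : Relator.LeftUnique R) (hl : α.Implements (fun x y => N.linner x y) 1 R)
    (hr : β.Implements (fun x y => N.rinner x y) 1 R) : α.MoritaEquivalent β := by
  have hl := hl.relZPow hα
  have hr := hr.relZPow hβ
  have hmem : ∀ s y, y ∈ N.leftSub (α.ideal s) ↔ ∃ x, relZPow R s x y := fun s y => by
    rw [N.mem_leftSub_iff]
    exact ⟨(hl s).ran y, fun ⟨x, hx⟩ => (hl s).mem_ran hx hx⟩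
  have hS : ∀ s, N.leftSub (α.ideal s) = N.rightSub (β.ideal s) := fun s => by
    ext y
    rw [hmem, N.mem_rightSub_iff]
    exact ⟨fun ⟨x, hx⟩ => (hr s).mem_ran hx hx, (hr s).ran y⟩
  have hex : ∀ s (x : N.leftSub (α.ideal (-s))), ∃ y : N.leftSub (α.ideal s),
      relZPow R s x y := fun s x => by
    obtain ⟨y, hy⟩ := (hl s).dom x (N.linner_mem x.2 _)
    exact ⟨⟨y, (hmem s y).mpr ⟨x, hy⟩⟩, hy⟩
  choose φ hφ using hex
  have hu := relZPow_rightUnique hRu hLu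
  refine ⟨M, _, _, N, hS, φ, hN, fun s => HilbertBimodule.isIso_of_inner _ (fun y => ?_)
    (fun x y => ?_) fun x y => ?_, fun s t x _ h₁ h₂ h₃ => ?_⟩
  · obtain ⟨x, hx⟩ := (hmem s y).mp y.2
    have hx' : x ∈ N.leftSub (α.ideal (-s)) := by
      rw [N.mem_leftSub_iff]
      obtain ⟨h, -⟩ := (hl s).map x x y y hx hx
      exact h
    exact ⟨⟨x, hx'⟩, Subtype.ext (hu s (hφ s ⟨x, hx'⟩) hx)⟩
  · obtain ⟨h, e⟩ := (hl s).map _ _ _ _ (hφ s x) (hφ s y)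
    exact Subtype.ext e
  · obtain ⟨h, e⟩ := (hr s).map _ _ _ _ (hφ s x) (hφ s y)
    exact Subtype.ext e
  · exact hu (s + t) (relZPow_comp hRu hLu (hφ t ⟨x, h₁⟩) (hφ s ⟨_, h₃⟩)) (hφ (s + t) ⟨x, h₂⟩)

theorem MoritaEquivalent.of_bimodule (hα : α.IsGeneratedByOne) (hβ : β.IsGeneratedByOne)
    (h : α.bimodule.MoritaEquivalent β.bimodule) : α.MoritaEquivalent β := by
  obtain ⟨M, _, _, N, Ψ, himp, hiso⟩ := h
  obtain ⟨U, hU, hUr, hUl⟩ := α.exists_isometry_tensor_left N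
  obtain ⟨V, hV, hVl, hVr⟩ := β.exists_isometry_tensor_right N
  have hU' : ∀ x, x ∈ N.leftSub (α.ideal (-1)) ↔ ∃ z, U z = x := fun x => by rw [← hU]; rfl
  have hV' : ∀ x, x ∈ N.rightSub (β.ideal 1) ↔ ∃ z, V z = x := fun x => by rw [← hV]; rfl
  have hUV : ∀ z w, ∃ h : N.linner (U z) (U w) ∈ α.ideal (-1),
      (α.map 1 ⟨_, h⟩ : A) = N.linner (V (Ψ z)) (V (Ψ w)) := fun z w => by
    have hm := N.linner_mem ((hU' (U z)).mpr ⟨z, rfl⟩) (U w)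
    exact ⟨hm, (hUl z w hm).trans ((hiso.map_linner z w).trans (hVl _ _).symm)⟩
  have hVU : ∀ z w, ∃ h : N.rinner (V (Ψ z)) (V (Ψ w)) ∈ β.ideal 1,
      ((β.map 1).symm ⟨_, h⟩ : B) = N.rinner (U z) (U w) := fun z w => by
    have hm := N.rinner_mem ((hV' (V (Ψ w))).mpr ⟨_, rfl⟩) (V (Ψ z))
    exact ⟨hm, (hVr _ _ hm).trans ((hiso.map_rinner z w).symm.trans (hUr z w).symm)⟩
  -- The inner products that generate `A_1`, and those that generate `B_{-1}`, are images of inner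
  -- products on the other side, and `⟨u, v⟩ · x = u · ⟨v, x⟩` moves the factor across.
  have hleft : N.leftSub (α.ideal 1) ≤ N.rightSub (β.ideal 1) := by
    refine himp.leftSub_le (α.map 1) (N.isClosed_rightSub _) fun u hu v hv hI x => ?_
    obtain ⟨z, rfl⟩ := (hU' u).mp hu
    obtain ⟨w, rfl⟩ := (hU' v).mp hv
    obtain ⟨_, e⟩ := hUV z w
    rw [e, N.linner_lsmul_eq]
    exact N.rsmul_mem_of_mem_rightSub ((hV' _).mpr ⟨_, rfl⟩) _
  have hright : N.rightSub (β.ideal (-1)) ≤ N.leftSub (α.ideal (-1)) := by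
    refine himp.rightSub_le (β.map 1).symm (N.isClosed_leftSub _) fun u hu v hv hJ x => ?_
    obtain ⟨z', rfl⟩ := (hV' u).mp hu
    obtain ⟨w', rfl⟩ := (hV' v).mp hv
    obtain ⟨z, rfl⟩ := hiso.surjective z'
    obtain ⟨w, rfl⟩ := hiso.surjective w'
    obtain ⟨_, e⟩ := hVU z w
    rw [e, ← N.linner_lsmul_eq]
    exact N.lsmul_mem_of_mem_leftSub ((hU' _).mpr ⟨_, rfl⟩) _
  have hdom : ∀ x ∈ N.leftSub (α.ideal (-1)), ∃ y z, U z = x ∧ V (Ψ z) = y := fun x hx => by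
    obtain ⟨z, hz⟩ := (hU' x).mp hx
    exact ⟨_, z, hz, rfl⟩
  have hran : ∀ y ∈ N.rightSub (β.ideal 1), ∃ x z, U z = x ∧ V (Ψ z) = y := fun y hy => by
    obtain ⟨w, hw⟩ := (hV' y).mp hy
    obtain ⟨z, rfl⟩ := hiso.surjective w
    exact ⟨_, z, rfl, hw⟩
  refine moritaEquivalent_of_implements hα hβ himp (R := fun x y => ∃ z, U z = x ∧ V (Ψ z) = y)
    ?_ ?_ ⟨fun x hx => hdom x (N.mem_leftSub_iff.mpr hx),
      fun y hy => hran y (hleft (N.mem_leftSub_iff.mpr hy)), ?_⟩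
    ⟨fun x hx => hdom x (hright (N.mem_rightSub_iff.mpr hx)),
      fun y hy => hran y (N.mem_rightSub_iff.mpr hy), ?_⟩
  · rintro _ _ _ ⟨z, rfl, rfl⟩ ⟨w, hw, rfl⟩
    rw [U.injective hw]
  · rintro _ _ _ ⟨z, rfl, rfl⟩ ⟨w, rfl, hw⟩
    rw [hiso.injective (V.injective hw)]
  · rintro _ _ _ _ ⟨z, rfl, rfl⟩ ⟨w, rfl, rfl⟩
    exact hUV z w
  · rintro _ _ _ _ ⟨z, rfl, rfl⟩ ⟨w, rfl, rfl⟩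
    obtain ⟨hm, e⟩ := hVU z w
    refine ⟨by rw [← e]; exact Subtype.prop _, ?_⟩
    have e' : (⟨N.rinner (U z) (U w), by rw [← e]; exact Subtype.prop _⟩ : β.ideal (-1)) =
        (β.map 1).symm ⟨_, hm⟩ := Subtype.ext e.symm
    rw [e', StarAlgEquiv.apply_symm_apply]

end PartialAction

theorem mainTheorem12 {A : Type u} {B : Type v} [NonUnitalCStarAlgebra A] [NonUnitalCStarAlgebra B]
    (α : PartialAction ℤ A) (β : PartialAction ℤ B) :
    (α.MoritaEquivalent β → α.bimodule.MoritaEquivalent β.bimodule) ∧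
    (α.IsGeneratedByOne → β.IsGeneratedByOne →
      (α.MoritaEquivalent β ↔ α.bimodule.MoritaEquivalent β.bimodule)) :=
  ⟨fun h => h.bimodule, fun hα hβ => ⟨fun h => h.bimodule, .of_bimodule hα hβ⟩⟩
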